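/- **Setting.** Let $\nu=(\nu_0,\nu_1,\nu_2)$ be pairwise distinct, pairwise coprime positive integers and let $q=(q_0,q_1,q_2)$ be positive integers such that $|\overline{q}|:=q_0+q_1+q_2-1$ is even. For $k\in\{0,1,2\}$ let $\mathbf q_k$ denote $q$ with its $k$-th entry replaced by $0$. For $n\in\mathbb Z^3$ put $n^{-\mathbf q}=\prod_j n_j^{-q_j}$, with $0^0=1$ and $0^{-m}=0$ for $m\ge 1$. Let $$Y_{k,\nu,q}=\sum_{\substack{n\in(\mathbb Z\setminus\{0\})^3\\ \nu_0n_0+\nu_1n_1+\nu_2n_2=0}} n^{-\mathbf q_k}.$$ Put $v_0=(0,\nu_2,\nu_1)$, $v_1=(\nu_2,0,\nu_0)$, $v_2=(\nu_1,\nu_0,0)$, and $u_0=(1,-1,-1)$, $u_1=(1,-1,1)$, $u_2=(1,1,-1)$, and $\sigma_{k,l}=\prod_{j\ne k}(u_l)_j^{q_j}$. For $l\in\{0,1,2\}$ let $(l',l'')=(l+1,l+2)$ modulo $3$, and let $0\le\epsilon_l<\nu_l$ be the unique integer with $(\epsilon_l v_{l'}+v_{l''})/\nu_l\in\mathbb Z^3$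 (so $\epsilon_l>0$ unless $\nu_l=1$). Let $(m_{l,i},\overline m_{l,i})_{0\le i\le s_l+1}$ be the Hirzebruch–Jung sequence of $(\nu_l,\epsilon_l)$: $(m_{l,0},\overline m_{l,0})=(\nu_l,0)$, $(m_{l,1},\overline m_{l,1})=(\epsilon_l,1)$, and $$m_{l,i+1}=\kappa_i m_{l,i}-m_{l,i-1},\qquad \overline m_{l,i+1}=\kappa_i\overline m_{l,i}-\overline m_{l,i-1},\qquad \kappa_i=\lceil m_{l,i-1}/m_{l,i}\rceil,$$ up to the first index $s_l+1$ with $m_{l,s_l+1}=0$. Let $v_{l,i}=(m_{l,i}v_{l'}+\overline m_{l,i}v_{l''})/\nu_l\in\mathbb Z^3$, and let $C_{l,i}$ $(0\le i\le s_l)$ be the relative interior $\{a v_{l,i}+b v_{l,i+1}: a,b>0\}$ of the unimodular cone spanned by $v_{l,i}$ and $v_{l,i+1}$. Define $$\zeta^*(\mathbf q_k,C_{l,i})=\sum_{\substack{n\in C_{l,i}\cap\mathbb Z^3\\ \gcd(n_0,n_1,n_2)=1}} n^{-\mathbf q_k},\qquad \mathcal Q_{k,\nu,q}=\sum_{l=0}^{2}\sigma_{k,l}\Bigl(\sum_{i=1}^{s_l}v_{l,i}^{-\mathbf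 q_k}+\sum_{i=0}^{s_l}\zeta^*(\mathbf q_k,C_{l,i})\Bigr).$$ **Convention on convergence.** If $q_j\ge 2$ for all $j\neq k$, the series in $Y_{k,\nu,q}$ and $\mathcal Q_{k,\nu,q}$ are ordinary sums. In general $Y_{k,\nu,q}$ and $\mathcal Q_{k,\nu,q}$ denote principal values: each of the series occurring in the definition is replaced by its partial sum over the points $n$ with $|n_j|\le N$ for $j=0,1,2$, and the limit $N\to\infty$ of the whole expression is taken. **Claim.** For every $k$ with $q_k=1$ (here $q_k$ is the entry of $q$) the principal values $Y_{k,\nu,q}$ and $\mathcal Q_{k,\nu,q}$ exist; if moreover $q_j\ge2$ for all $j\ne k$, then the series defining $Y_{k,\nu,q}$ and all $\zeta^*(\mathbf q_k,C_{l,i})$ converge absolutely, and the principal values are the ordinary values. Furthermore $$\sum_{k:\,q_k=1}Y_{k,\nu,q}=2\,\zeta(|\overline{q}|)\sum_{k:\,q_k=1}\mathcal Q_{k,\nu,q}.$$ -/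

import Mathlib

open Filter Topology

namespace ConicalReciprocity

noncomputable section

/-- The vector `q_k`: the vector `q` with its `k`-th coordinate replaced by `0`. -/
def dropAt (q : Fin 3 → ℕ) (k : Fin 3) : Fin 3 → ℕ := Function.update q k 0

/-- `1 / n^q = ∏ j, n_j ^ (-q_j)`.  In Lean `0 ^ 0 = 1` and `0⁻¹ = 0`, which are the conventions
`0^0 = 1` and `0^(-q) = 0` for `q ≥ 1`. -/
def invPow (n : Fin 3 → ℤ) (q : Fin 3 → ℕ) : ℝ := ∏ j, ((n j : ℝ) ^ q j)⁻¹

/-- `|q̄| = q_0 + q_1 + q_2 - 1`; only used for `q` with positive entries. -/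
def barWeight (q : Fin 3 → ℕ) : ℕ := (∑ j, q j) - 1

/-- Integer vectors orthogonal to `ν`, all of whose coordinates are nonzero. -/
def perp (ν : Fin 3 → ℕ) : Set (Fin 3 → ℤ) :=
  {n | (∑ j, (ν j : ℤ) * n j = 0) ∧ ∀ j, n j ≠ 0}

open scoped Classical in
/-- The integer points `n` of `S` with `|n_j| ≤ N` for all `j`. -/
def boxed (S : Set (Fin 3 → ℤ)) (N : ℕ) : Finset (Fin 3 → ℤ) :=
  (Fintype.piFinset fun _ => Finset.Icc (-(N : ℤ)) (N : ℤ)).filter (fun n => n ∈ S)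

/-- Symmetric partial sum `∑ 1 / n^q` over the points of `S` in the cube `[-N, N]^3`. -/
def partialSum (S : Set (Fin 3 → ℤ)) (q : Fin 3 → ℕ) (N : ℕ) : ℝ :=
  ∑ n ∈ boxed S N, invPow n q

/-- Symmetric partial sums of `Y_{k,ν,q} = ∑ 1 / n^{q_k}`. -/
def YPartial (k : Fin 3) (ν q : Fin 3 → ℕ) (N : ℕ) : ℝ :=
  partialSum (perp ν) (dropAt q k) N

/-- The sign vectors `u_0 = (1,-1,-1)`, `u_1 = (1,-1,1)`, `u_2 = (1,1,-1)`. -/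
def signVec : Fin 3 → Fin 3 → ℤ := ![![1, -1, -1], ![1, -1, 1], ![1, 1, -1]]

/-- `σ_{k,l} = ∏_{j ≠ k} (u_l)_j ^ q_j`. -/
def sign (q : Fin 3 → ℕ) (k l : Fin 3) : ℤ := ∏ j, signVec l j ^ dropAt q k j

/-- The vectors `v_0 = (0,ν_2,ν_1)`, `v_1 = (ν_2,0,ν_0)`, `v_2 = (ν_1,ν_0,0)`. -/
def edge (ν : Fin 3 → ℕ) : Fin 3 → Fin 3 → ℤ :=
  ![![0, (ν 2 : ℤ), (ν 1 : ℤ)], ![(ν 2 : ℤ), 0, (ν 0 : ℤ)], ![(ν 1 : ℤ), (ν 0 : ℤ), 0]]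

/-- `ε_l`: the least natural number such that `(ε_l v_{l'} + v_{l''}) / ν_l` is integral, where
`(l', l'') = (l + 1, l + 2)` modulo `3`.  As the integrality condition only depends on the class
modulo `ν_l`, this is the unique solution with `0 ≤ ε_l < ν_l`; it is `0` only if `ν_l = 1`. -/
def epsilon (ν : Fin 3 → ℕ) (l : Fin 3) : ℕ :=
  sInf {e : ℕ | ∀ j, (ν l : ℤ) ∣ (e : ℤ) * edge ν (l + 1) j + edge ν (l + 2) j}

/-- The Hirzebruch–Jung sequence `(m_i, m̄_i)` of the pair `(a, b)`: it starts with `(a, 0)`,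
`(b, 1)` and satisfies `m_{i+1} = κ_i m_i - m_{i-1}`, `m̄_{i+1} = κ_i m̄_i - m̄_{i-1}` with
`κ_i = ⌈m_{i-1} / m_i⌉`.  It is used up to the first index where `m` vanishes. -/
def hj (a b : ℕ) : ℕ → ℤ × ℤ
  | 0 => ((a : ℤ), 0)
  | 1 => ((b : ℤ), 1)
  | (i + 2) =>
    let κ : ℤ := ⌈((hj a b i).1 : ℚ) / ((hj a b (i + 1)).1 : ℚ)⌉
    (κ * (hj a b (i + 1)).1 - (hj a b i).1, κ * (hj a b (i + 1)).2 - (hj a b i).2)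

/-- The length `s` of the Hirzebruch–Jung sequence: the first `s` with `m_{s+1} = 0`. -/
def hjLength (a b : ℕ) : ℕ := sInf {s : ℕ | (hj a b (s + 1)).1 = 0}

/-- `s_l`. -/
def rayCount (ν : Fin 3 → ℕ) (l : Fin 3) : ℕ := hjLength (ν l) (epsilon ν l)

/-- `v_{l,i} = (m_{l,i} v_{l'} + m̄_{l,i} v_{l''}) / ν_l` for `0 ≤ i ≤ s_l + 1`
(the division is exact). -/
def ray (ν : Fin 3 → ℕ) (l : Fin 3) (i : ℕ) : Fin 3 → ℤ := fun j =>
  ((hj (ν l) (epsilon ν l) i).1 * edge ν (l + 1) j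
    + (hj (ν l) (epsilon ν l) i).2 * edge ν (l + 2) j) / (ν l : ℤ)

/-- The relative interior of the plane cone spanned by two (independent) integer vectors. -/
def openCone (v w : Fin 3 → ℤ) : Set (Fin 3 → ℝ) :=
  {x | ∃ a b : ℝ, 0 < a ∧ 0 < b ∧ ∀ j, x j = a * (v j : ℝ) + b * (w j : ℝ)}

/-- The primitive integer points (coordinates of greatest common divisor `1`) of a set. -/
def primitivePoints (C : Set (Fin 3 → ℝ)) : Set (Fin 3 → ℤ) :=
  {n | (fun j => (n j : ℝ)) ∈ C ∧ Finset.univ.gcd n = 1}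

/-- The (relative interior of the) unimodular cone `C_{l,i} = C(v_{l,i}, v_{l,i+1})`. -/
def subCone (ν : Fin 3 → ℕ) (l : Fin 3) (i : ℕ) : Set (Fin 3 → ℝ) :=
  openCone (ray ν l i) (ray ν l (i + 1))

/-- The reduced conical zeta value `ζ^*(q, C) = ∑ 1 / n^q` over the primitive integer points. -/
def reducedZeta (q : Fin 3 → ℕ) (C : Set (Fin 3 → ℝ)) : ℝ :=
  ∑' n : primitivePoints C, invPow n q

/-- `∑_l σ_{k,l} (∑_{i=1}^{s_l} 1 / v_{l,i}^{q_k} + ∑_{i=0}^{s_l} Z_{l,i})` for given values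
`Z_{l,i}` attached to the cones `C_{l,i}`. -/
def combine (k : Fin 3) (ν q : Fin 3 → ℕ) (Z : Fin 3 → ℕ → ℝ) : ℝ :=
  ∑ l, (sign q k l : ℝ) *
    (∑ i ∈ Finset.Icc 1 (rayCount ν l), invPow (ray ν l i) (dropAt q k)
      + ∑ i ∈ Finset.range (rayCount ν l + 1), Z l i)

/-- `Q_{k,ν,q}`, for absolutely convergent reduced conical zeta values. -/
def Q (k : Fin 3) (ν q : Fin 3 → ℕ) : ℝ :=
  combine k ν q fun l i => reducedZeta (dropAt q k) (subCone ν l i)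

/-- Symmetric partial sums of `Q_{k,ν,q}`: every series `ζ^*(q_k, C_{l,i})` is replaced by its
partial sum over the points of the cube `[-N, N]^3`. -/
def QPartial (k : Fin 3) (ν q : Fin 3 → ℕ) (N : ℕ) : ℝ :=
  combine k ν q fun l i => partialSum (primitivePoints (subCone ν l i)) (dropAt q k) N

end

end ConicalReciprocity

/-! The identity holds for each `k` with `q k = 1` separately. Put `w = |q̄|`. Sorting the points of
`perp ν` in the cube of size `N` by their gcd `d` writes the cube sum as a convolution of `d⁻ʷ` with
the sums over primitive points at size `⌊N / d⌋`; Möbius inversion gives the converse formula. Since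
`w ≥ 2`, dominated convergence applies both ways: a limit for `Y` yields one for the primitive sums,
and the two differ by the factor `ζ(w)` (`exists_tendsto_primPerp`). The coordinates of a point of
`perp ν` have one of the six sign patterns `±u_l`. As `w` is even, `n` and `-n` contribute equally,
so the primitive sum is twice the signed sum over three positive cones (`partialSum_primPerp`), and
the Hirzebruch–Jung rays cut each cone into rays and open subcones (`partialSum_primCone`).

The analytic core is the existence of the limit of `Y`. If both remaining exponents are at least
`2`, convergence is absolute. Otherwise one of them is `1`, and parity makes the other, `a`, odd.
Eliminating `n_k` leaves the sum of `x⁻ᵃ y⁻¹` over `y ≡ κ x` modulo `m = ν_k` in a hexagon; the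
extra points with `n_k = 0` form an absolutely convergent series. Over a rectangle the sum splits,
by residue classes of `x`, into products of convergent one-dimensional sums (`exists_tendsto_rect`).
For fixed `x > 0`, if the hexagon allows `-A ≤ y ≤ B`, hexagon minus rectangle is `-log(A / B) / m`
up to `O(1 / B)`. Summed against `x⁻ᵃ` this tends to `0` for `a ≥ 3`; for `a = 1` it is a Riemann
sum, under control if `ν_i < ν_k` keeps `B` comparable to `N`. When all exponents are `1`, this
settles every `k` except that of the least `ν_k`, and the relation `∑ ν_k Y_k = 0` supplies the last
one. -/

/-! ### Harmonic sums over arithmetic progressions -/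

/-- The sum of `1 / y` over the integers `a < y ≤ b` with `y ≡ ρ` modulo `m`. -/
noncomputable def apSum (m ρ a b : ℤ) : ℝ :=
  ∑ y ∈ Finset.Ioc a b with y ≡ ρ [ZMOD m], (y : ℝ)⁻¹

lemma apSum_add {m ρ a b c : ℤ} (hab : a ≤ b) (hbc : b ≤ c) :
    apSum m ρ a b + apSum m ρ b c = apSum m ρ a c := by
  unfold apSum
  rw [← Finset.sum_union, ← Finset.filter_union, Finset.Ioc_union_Ioc_eq_Ioc hab hbc]
  exact Finset.disjoint_filter_filter (by
    rw [Finset.disjoint_left]; intro x hx hx'; simp only [Finset.mem_Ioc] at hx hx'; omega)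

/-- Compares `1 / y` with the mean of `1 / t` over `[y, y + m]`. The upper bound is in a form that
telescopes along a progression of step `m`. -/
lemma inv_sub_log_div_mem {m y : ℝ} (hm : 0 < m) (hy : 0 < y) :
    0 ≤ y⁻¹ - Real.log ((y + m) / y) / m ∧
      y⁻¹ - Real.log ((y + m) / y) / m ≤ y⁻¹ - (y + m)⁻¹ := by
  have hpos : 0 < (y + m) / y := by positivity
  constructor
  · have h := Real.log_le_sub_one_of_pos hpos
    have h2 : (y + m) / y - 1 = y⁻¹ * m := by field_simp; ring
    rw [h2] at h
    have := (div_le_iff₀ hm).2 h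
    linarith
  · have h := Real.one_sub_inv_le_log_of_pos hpos
    have h2 : 1 - ((y + m) / y)⁻¹ = (y + m)⁻¹ * m := by field_simp; ring
    rw [h2] at h
    have := (le_div_iff₀ hm).2 h
    linarith

lemma sum_Ioc_ap_telescope {m : ℤ} (hm : 0 < m) (ρ : ℤ) {s t : ℤ} (hst : s ≤ t)
    (hs : 0 < ρ + m * (s + 1)) :
    0 ≤ ∑ i ∈ Finset.Ioc s t, ((ρ + m * i : ℤ) : ℝ)⁻¹
        - Real.log (((ρ + m * (t + 1) : ℤ) : ℝ) / ((ρ + m * (s + 1) : ℤ) : ℝ)) / m ∧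
      ∑ i ∈ Finset.Ioc s t, ((ρ + m * i : ℤ) : ℝ)⁻¹
        - Real.log (((ρ + m * (t + 1) : ℤ) : ℝ) / ((ρ + m * (s + 1) : ℤ) : ℝ)) / m
      ≤ ((ρ + m * (s + 1) : ℤ) : ℝ)⁻¹ - ((ρ + m * (t + 1) : ℤ) : ℝ)⁻¹ := by
  induction t, hst using Int.leInduction with
  | base =>
    simp
  | succ t hst ih =>
    have hy : (0 : ℝ) < ((ρ + m * (t + 1) : ℤ) : ℝ) := by
      have : ρ + m * (s + 1) ≤ ρ + m * (t + 1) := by gcongr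
      exact_mod_cast hs.trans_le this
    have hs' : (0 : ℝ) < ((ρ + m * (s + 1) : ℤ) : ℝ) := by exact_mod_cast hs
    have hm' : (0 : ℝ) < m := by exact_mod_cast hm
    have key := inv_sub_log_div_mem hm' hy
    have he : ((ρ + m * (t + 1 + 1) : ℤ) : ℝ) = ((ρ + m * (t + 1) : ℤ) : ℝ) + m := by
      push_cast; ring
    have hins : Finset.Ioc s (t + 1) = insert (t + 1) (Finset.Ioc s t) := by
      ext x; simp only [Finset.mem_Ioc, Finset.mem_insert]; omega
    rw [hins, Finset.sum_insert (by simp), he]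
    generalize ((ρ + m * (t + 1) : ℤ) : ℝ) = Y at *
    generalize ((ρ + m * (s + 1) : ℤ) : ℝ) = X at *
    have hlog : Real.log ((Y + m) / X) = Real.log ((Y + m) / Y) + Real.log (Y / X) := by
      rw [← Real.log_mul (by positivity) (by positivity)]; congr 1; field_simp
    rw [hlog, add_div]
    constructor <;> linarith [key.1, key.2, ih.1, ih.2]

lemma apSum_estimate {m : ℤ} (hm : 0 < m) (ρ : ℤ) {u v : ℝ} (hu : 0 < u) (huv : u ≤ v) :
    |apSum m ρ ⌊u⌋ ⌊v⌋ - Real.log (v / u) / m| ≤ 3 / u := by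
  have hm' : (0 : ℝ) < m := by exact_mod_cast hm
  set s : ℤ := (⌊u⌋ - ρ) / m with hs
  set t : ℤ := (⌊v⌋ - ρ) / m with ht
  have hst : s ≤ t := Int.ediv_le_ediv hm (by have := Int.floor_mono huv; omega)
  -- The first term of the progression beyond `w` lies in `(w, w + m]`. The error `3 / u` consists
  -- of one `1 / u` from the telescoped bound and two from replacing these first terms by `u` and
  -- `v` inside the logarithm.
  have bound : ∀ w : ℝ, w < ((ρ + m * ((⌊w⌋ - ρ) / m + 1) : ℤ) : ℝ) ∧
      ((ρ + m * ((⌊w⌋ - ρ) / m + 1) : ℤ) : ℝ) ≤ w + m := by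
    intro w
    have h1 := Int.mul_ediv_add_emod (⌊w⌋ - ρ) m
    have h2 := Int.emod_lt_of_pos (⌊w⌋ - ρ) hm
    have h3 := Int.emod_nonneg (⌊w⌋ - ρ) hm.ne'
    constructor
    · rw [← Int.floor_lt]; linarith
    · have : ρ + m * ((⌊w⌋ - ρ) / m + 1) ≤ ⌊w⌋ + m := by linarith
      calc ((ρ + m * ((⌊w⌋ - ρ) / m + 1) : ℤ) : ℝ) ≤ ((⌊w⌋ + m : ℤ) : ℝ) := by exact_mod_cast this
        _ ≤ w + m := by push_cast; linarith [Int.floor_le w]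
  obtain ⟨hu1, hu2⟩ := bound u
  obtain ⟨hv1, hv2⟩ := bound v
  rw [← hs] at hu1 hu2
  rw [← ht] at hv1 hv2
  have hpos : 0 < ρ + m * (s + 1) := by
    have := hu.trans hu1
    exact_mod_cast this
  have hsum : apSum m ρ ⌊u⌋ ⌊v⌋ = ∑ i ∈ Finset.Ioc s t, ((ρ + m * i : ℤ) : ℝ)⁻¹ := by
    unfold apSum
    symm
    apply Finset.sum_nbij (fun i => ρ + m * i)
    · intro i hi
      simp only [Finset.mem_Ioc, Finset.mem_filter] at hi ⊢
      refine ⟨⟨?_, ?_⟩, ?_⟩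
      · have := (Int.ediv_lt_iff_lt_mul hm).1 hi.1
        linarith [mul_comm i m]
      · have := (Int.le_ediv_iff_mul_le hm).1 hi.2
        linarith [mul_comm i m]
      · exact (Int.modEq_iff_dvd.2 ⟨-i, by ring⟩)
    · intro i _ j _ h
      have : m * i = m * j := by simpa using h
      exact mul_left_cancel₀ hm.ne' this
    · intro y hy
      simp only [Finset.coe_filter, Finset.mem_Ioc, Set.mem_ofPred_eq] at hy
      obtain ⟨c, hc⟩ := Int.modEq_iff_dvd.1 hy.2.symm
      refine ⟨c, ?_, by simp; linarith⟩
      simp only [Finset.coe_Ioc, Set.mem_Ioc]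
      exact ⟨(Int.ediv_lt_iff_lt_mul hm).2 (by linarith [mul_comm c m]),
        (Int.le_ediv_iff_mul_le hm).2 (by linarith [mul_comm c m])⟩
    · intros; rfl
  obtain ⟨h1, h2⟩ := sum_Ioc_ap_telescope hm ρ hst hpos
  rw [hsum]
  generalize ∑ i ∈ Finset.Ioc s t, ((ρ + m * i : ℤ) : ℝ)⁻¹ = S at *
  generalize ((ρ + m * (s + 1) : ℤ) : ℝ) = X at *
  generalize ((ρ + m * (t + 1) : ℤ) : ℝ) = Y at *
  have hX : 0 < X := hu.trans hu1
  have hv : 0 < v := hu.trans_le huv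
  have hY : 0 < Y := hv.trans hv1
  have logb : ∀ a b : ℝ, 0 < a → a < b → b ≤ a + m →
      0 ≤ Real.log (b / a) / m ∧ Real.log (b / a) / m ≤ 1 / a := by
    intro a b ha hab hb
    have hb0 := ha.trans hab
    refine ⟨div_nonneg (Real.log_nonneg ((one_le_div ha).2 hab.le)) hm'.le, ?_⟩
    rw [div_le_iff₀ hm']
    have h := Real.log_le_sub_one_of_pos (show 0 < b / a by positivity)
    have h2 : b / a ≤ (a + m) / a := by gcongr
    have h3 : (a + m) / a = 1 + 1 / a * m := by field_simp
    linarith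
  obtain ⟨lu1, lu2⟩ := logb u X hu hu1 hu2
  obtain ⟨lv1, lv2⟩ := logb v Y hv hv1 hv2
  have hlog : Real.log (Y / X) / m
      = Real.log (Y / v) / m + Real.log (v / u) / m - Real.log (X / u) / m := by
    rw [Real.log_div hY.ne' hX.ne', Real.log_div hY.ne' hv.ne', Real.log_div hv.ne' hu.ne',
      Real.log_div hX.ne' hu.ne']
    ring
  have hvu : 1 / v ≤ 1 / u := one_div_le_one_div_of_le hu huv
  have hXu : X⁻¹ ≤ 1 / u := by rw [← one_div]; exact one_div_le_one_div_of_le hu hu1.le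
  have hY' : 0 < Y⁻¹ := by positivity
  have h3 : 3 / u = 1 / u + 1 / u + 1 / u := by ring
  rw [hlog] at h1 h2
  rw [abs_le, h3]
  have : 0 < 1 / u := by positivity
  constructor <;> linarith

/-- The sum of `1 / y` over the integers `|y| ≤ b`, `y ≠ 0`, with `y ≡ ρ` modulo `m`. -/
noncomputable def apSymm (m ρ b : ℤ) : ℝ := apSum m ρ 0 b - apSum m (-ρ) 0 b

lemma sum_Icc_modEq_inv (m ρ : ℤ) {a b : ℤ} (ha : 0 ≤ a) (hb : 0 ≤ b) :
    ∑ y ∈ Finset.Icc (-a) b with y ≡ ρ [ZMOD m], (y : ℝ)⁻¹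
      = apSum m ρ 0 b - apSum m (-ρ) 0 a := by
  have hneg : -apSum m (-ρ) 0 a
      = ∑ y ∈ Finset.Ico (-a) 0 with y ≡ ρ [ZMOD m], (y : ℝ)⁻¹ := by
    unfold apSum
    rw [← Finset.sum_neg_distrib]
    refine Finset.sum_nbij' (fun y => -y) (fun y => -y) ?_ ?_ ?_ ?_ ?_
    · intro y hy
      simp only [Finset.mem_filter, Finset.mem_Ioc, Finset.mem_Ico] at hy ⊢
      exact ⟨by omega, by simpa using hy.2.neg⟩
    · intro y hy
      simp only [Finset.mem_filter, Finset.mem_Ioc, Finset.mem_Ico] at hy ⊢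
      exact ⟨by omega, hy.2.neg⟩
    · simp
    · simp
    · intro y _; push_cast; rw [inv_neg]
  rw [sub_eq_add_neg, hneg]
  unfold apSum
  rw [← Finset.sum_union, ← Finset.filter_union]
  · symm
    apply Finset.sum_subset
    · intro y hy
      simp only [Finset.mem_filter, Finset.mem_union, Finset.mem_Ioc, Finset.mem_Ico,
        Finset.mem_Icc] at hy ⊢
      exact ⟨by omega, hy.2⟩
    · intro y hy hy'
      simp only [Finset.mem_filter, Finset.mem_union, Finset.mem_Ioc, Finset.mem_Ico,
        Finset.mem_Icc] at hy hy'
      -- The point `y = 0` may belong to the residue class, but it contributes `0⁻¹ = 0`.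
      have : y = 0 := by
        by_contra h
        exact hy' ⟨by omega, hy.2⟩
      simp [this]
  · exact Finset.disjoint_filter_filter (by
      rw [Finset.disjoint_left]; intro x hx hx'; simp only [Finset.mem_Ioc, Finset.mem_Ico] at hx hx'
      omega)

lemma apSymm_eq (m ρ : ℤ) {b : ℤ} (hb : 0 ≤ b) :
    apSymm m ρ b = ∑ y ∈ Finset.Icc (-b) b with y ≡ ρ [ZMOD m], (y : ℝ)⁻¹ :=
  (sum_Icc_modEq_inv m ρ hb hb).symm

/-- The classes `ρ` and `-ρ` have the same logarithmic growth `log b / m`, which cancels in the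
difference; what remains is Cauchy with error `6 / b`. -/
lemma exists_tendsto_apSymm {m : ℤ} (hm : 0 < m) (ρ : ℤ) :
    ∃ L, Tendsto (fun b : ℝ => apSymm m ρ ⌊b⌋) atTop (𝓝 L) := by
  have hC : CauchySeq (fun b : ℝ => apSymm m ρ ⌊max b 1⌋) := by
    apply cauchySeq_of_le_tendsto_0' (fun b : ℝ => 6 / max b 1)
    · intro u v huv
      have h1 : (0 : ℝ) < max u 1 := by positivity
      have h2 : max u 1 ≤ max v 1 := max_le_max_right _ huv
      have e1 := apSum_estimate hm ρ h1 h2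
      have e2 := apSum_estimate hm (-ρ) h1 h2
      have h0 : 0 ≤ ⌊max u 1⌋ := Int.floor_nonneg.2 h1.le
      have hf := Int.floor_mono h2
      have a1 := apSum_add (m := m) (ρ := ρ) h0 hf
      have a2 := apSum_add (m := m) (ρ := -ρ) h0 hf
      rw [Real.dist_eq, apSymm, apSymm, ← a1, ← a2]
      rw [abs_le] at *
      have : 6 / max u 1 = 3 / max u 1 + 3 / max u 1 := by ring
      constructor <;> linarith [e1.1, e1.2, e2.1, e2.2]
    · apply Tendsto.const_div_atTop
      exact tendsto_atTop_mono (fun b => le_max_left b 1) tendsto_id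
  obtain ⟨L, hL⟩ := cauchySeq_tendsto_of_complete hC
  refine ⟨L, hL.congr' ?_⟩
  filter_upwards [eventually_ge_atTop 1] with b hb
  rw [max_eq_left hb]

/-! ### A Riemann sum criterion -/

/-- Riemann sums `∑_{1 ≤ x ≤ N} F N x` whose rescaled terms `N * F N x` are uniformly bounded and
converge pointwise, converge to the integral of the limit. -/
lemma tendsto_sum_Ioc_of_rescaled {F : ℕ → ℕ → ℝ} {ψ : ℝ → ℝ} {C : ℝ}
    (hC : ∀ N x : ℕ, 1 ≤ x → x ≤ N → |N * F N x| ≤ C)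
    (hψ : ∀ t : ℝ, 0 < t → t < 1 →
      Tendsto (fun N : ℕ => N * F N ⌈(N : ℝ) * t⌉₊) atTop (𝓝 (ψ t))) :
    Tendsto (fun N : ℕ => ∑ x ∈ Finset.Ioc 0 N, F N x) atTop (𝓝 (∫ t in (0 : ℝ)..1, ψ t)) := by
  -- The sum is the integral over `[0, 1]` of the step function `t ↦ N * F N ⌈N t⌉`, to which
  -- dominated convergence applies.
  have hmeas : ∀ N : ℕ, Measurable (fun t : ℝ => (N : ℝ) * F N ⌈(N : ℝ) * t⌉₊) := fun N =>
    (measurable_from_nat (f := fun x => (N : ℝ) * F N x)).comp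
      (Nat.measurable_ceil.comp (measurable_const_mul (N : ℝ)))
  have hbd : ∀ (N : ℕ) (t : ℝ), t ∈ Set.uIoc (0 : ℝ) 1 → 0 < N →
      |(N : ℝ) * F N ⌈(N : ℝ) * t⌉₊| ≤ C := by
    intro N t ht hN
    rw [Set.uIoc_of_le zero_le_one] at ht
    have hN' : (0 : ℝ) < N := by exact_mod_cast hN
    apply hC
    · exact Nat.one_le_iff_ne_zero.2 (Nat.ceil_pos.2 (mul_pos hN' ht.1)).ne'
    · apply Nat.ceil_le.2
      nlinarith [ht.2]
  have key : Tendsto (fun N : ℕ => ∫ t in (0 : ℝ)..1, (N : ℝ) * F N ⌈(N : ℝ) * t⌉₊) atTop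
      (𝓝 (∫ t in (0 : ℝ)..1, ψ t)) := by
    apply intervalIntegral.tendsto_integral_filter_of_dominated_convergence (fun _ => C)
    · exact Eventually.of_forall fun N => (hmeas N).aestronglyMeasurable
    · filter_upwards [eventually_gt_atTop 0] with N hN
      exact Eventually.of_forall fun t ht => hbd N t ht hN
    · exact intervalIntegrable_const
    · filter_upwards [MeasureTheory.Measure.ae_ne MeasureTheory.volume (1 : ℝ)] with t ht1 ht
      rw [Set.uIoc_of_le zero_le_one] at ht
      exact hψ t ht.1 (lt_of_le_of_ne ht.2 ht1)
  refine key.congr' ?_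
  filter_upwards [eventually_gt_atTop 0] with N hN
  have hN' : (0 : ℝ) < N := by exact_mod_cast hN
  have hpart : ∀ k < N, ∫ t in ((k : ℝ) / N)..((k + 1 : ℕ) : ℝ) / N,
      (N : ℝ) * F N ⌈(N : ℝ) * t⌉₊ = F N (k + 1) := by
    intro k _
    have hle : (k : ℝ) / N ≤ ((k + 1 : ℕ) : ℝ) / N := by push_cast; gcongr; linarith
    rw [intervalIntegral.integral_congr_Ioo_of_le hle (g := fun _ => (N : ℝ) * F N (k + 1))]
    · rw [intervalIntegral.integral_const, smul_eq_mul]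
      push_cast; field_simp; ring
    · intro t ht
      have h1 : (k : ℝ) < N * t := by rw [mul_comm]; exact (div_lt_iff₀ hN').1 ht.1
      have h2 : N * t < ((k + 1 : ℕ) : ℝ) := by rw [mul_comm]; exact (lt_div_iff₀ hN').1 ht.2
      have : ⌈(N : ℝ) * t⌉₊ = k + 1 := by
        rw [Nat.ceil_eq_iff (by omega)]
        exact ⟨by simpa using h1, h2.le⟩
      simp only [this]
  have hsum := intervalIntegral.sum_integral_adjacent_intervals
    (f := fun t : ℝ => (N : ℝ) * F N ⌈(N : ℝ) * t⌉₊) (μ := MeasureTheory.volume)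
    (a := fun k : ℕ => (k : ℝ) / N) (n := N) (by
      intro k hk
      rw [intervalIntegrable_iff]
      apply MeasureTheory.Measure.integrableOn_of_bounded (M := C) (by simp)
        (hmeas N).aestronglyMeasurable
      filter_upwards [MeasureTheory.ae_restrict_mem measurableSet_uIoc] with t ht
      apply hbd N t _ hN
      have hle : (k : ℝ) / N ≤ ((k + 1 : ℕ) : ℝ) / N := by push_cast; gcongr; linarith
      rw [Set.uIoc_of_le hle] at ht
      rw [Set.uIoc_of_le zero_le_one]
      refine ⟨lt_of_le_of_lt (by positivity) ht.1, ht.2.trans ?_⟩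
      rw [div_le_one hN']; exact_mod_cast hk)
  simp only [Nat.cast_zero, zero_div, div_self hN'.ne'] at hsum
  rw [← hsum, Finset.sum_congr rfl (fun k hk => hpart k (Finset.mem_range.1 hk))]
  rw [Finset.range_eq_Ico, Finset.sum_Ico_add' (fun k => F N k) 0 N 1]
  rfl

/-! ### Hexagonal and rectangular sums -/

/-- For fixed `x`, the sum of `1 / y` over the `y ≡ κ x` modulo `m`, `y ≠ 0`, in the hexagon
`|x|, |y| ≤ N`, `|p x + r y| ≤ m N`. -/
noncomputable def hexSum (m κ p r : ℤ) (N : ℕ) (x : ℤ) : ℝ :=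
  ∑ y ∈ Finset.Icc (-(N : ℤ)) N with y ≡ κ * x [ZMOD m] ∧ |p * x + r * y| ≤ m * N, (y : ℝ)⁻¹

/-- For fixed `x`, the sum of `1 / y` over the `y ≡ κ x` modulo `m`, `y ≠ 0`, in the rectangle
`|x|, |y| ≤ N`, `r |y| ≤ m N`. -/
noncomputable def rectSum (m κ r : ℤ) (N : ℕ) (x : ℤ) : ℝ :=
  apSymm m (κ * x) ⌊min 1 ((m : ℝ) / r) * N⌋

lemma hexSum_neg (m κ p r : ℤ) (N : ℕ) (x : ℤ) :
    hexSum m κ p r N (-x) = -hexSum m κ p r N x := by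
  unfold hexSum
  rw [← Finset.sum_neg_distrib]
  have key : ∀ x y : ℤ, y ∈ (Finset.Icc (-(N : ℤ)) N).filter
      (fun y => y ≡ κ * -x [ZMOD m] ∧ |p * -x + r * y| ≤ m * N) →
      -y ∈ (Finset.Icc (-(N : ℤ)) N).filter
        (fun y => y ≡ κ * x [ZMOD m] ∧ |p * x + r * y| ≤ m * N) := by
    intro x y hy
    simp only [Finset.mem_filter, Finset.mem_Icc] at hy ⊢
    refine ⟨by omega, by simpa using hy.2.1.neg, ?_⟩
    rw [← abs_neg]
    convert hy.2.2 using 2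
    ring
  refine Finset.sum_nbij' (fun y => -y) (fun y => -y) (key x) ?_ ?_ ?_ ?_
  · intro y hy
    have := key (-x) y (by simpa using hy)
    exact this
  · simp
  · simp
  · intro y _; push_cast; rw [inv_neg, neg_neg]

lemma rectSum_neg (m κ r : ℤ) (N : ℕ) (x : ℤ) :
    rectSum m κ r N (-x) = -rectSum m κ r N x := by
  simp [rectSum, apSymm]

lemma hexSum_eq {m κ p r : ℤ} (hr : 0 < r) {N : ℕ} {x : ℤ}
    (hA : 0 ≤ min (N : ℝ) ((m * N + p * x) / r)) (hB : 0 ≤ min (N : ℝ) ((m * N - p * x) / r)) :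
    hexSum m κ p r N x = apSum m (κ * x) 0 ⌊min (N : ℝ) ((m * N - p * x) / r)⌋
      - apSum m (-(κ * x)) 0 ⌊min (N : ℝ) ((m * N + p * x) / r)⌋ := by
  rw [← sum_Icc_modEq_inv m _ (Int.floor_nonneg.2 hA) (Int.floor_nonneg.2 hB)]
  unfold hexSum
  apply Finset.sum_congr _ (fun _ _ => rfl)
  have hr' : (0 : ℝ) < r := by exact_mod_cast hr
  ext y
  have h1 : y ≤ ⌊min (N : ℝ) ((m * N - p * x) / r)⌋ ↔ y ≤ N ∧ y * r ≤ m * N - p * x := by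
    rw [Int.le_floor, le_min_iff, le_div_iff₀ hr']; norm_cast
  have h2 : -⌊min (N : ℝ) ((m * N + p * x) / r)⌋ ≤ y ↔ -y ≤ N ∧ -y * r ≤ m * N + p * x := by
    rw [neg_le, Int.le_floor, le_min_iff, le_div_iff₀ hr']; norm_cast
  simp only [Finset.mem_filter, Finset.mem_Icc, h1, h2, abs_le]
  constructor
  · rintro ⟨⟨a, b⟩, c, d, e⟩
    exact ⟨⟨⟨by omega, by linarith⟩, b, by linarith⟩, c⟩
  · rintro ⟨⟨⟨a, b⟩, c, d⟩, e⟩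
    exact ⟨⟨by omega, c⟩, e, by linarith, by linarith⟩

/-- Let `A`, `B` bound `-y` and `y` in the hexagon and `E` bound `|y|` in the rectangle; then `B ≤ E
≤ A`. The difference is minus two progression sums, over `(B, E]` and `(E, A]`, whose logarithms add
up to `log(A / B)`. The second bound follows from `log(A / B) ≤ (A - B) / B` and `A - B ≤ 2 p x /
r`. -/
lemma hexSum_sub_rectSum_estimate {m κ p r : ℤ} (hm : 0 < m) (hp : 0 < p) (hr : 0 < r)
    {N : ℕ} {x : ℤ} (hx : 0 < x) {β : ℝ} (hβ : 0 < β)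
    (hB : β ≤ min (N : ℝ) ((m * N - p * x) / r)) :
    |hexSum m κ p r N x - rectSum m κ r N x
      + Real.log (min (N : ℝ) ((m * N + p * x) / r) / min (N : ℝ) ((m * N - p * x) / r)) / m|
        ≤ 6 / β ∧
    |hexSum m κ p r N x - rectSum m κ r N x| ≤ (6 + 2 * p / r * x) / β := by
  have hm' : (0 : ℝ) < m := by exact_mod_cast hm
  have hm1 : (1 : ℝ) ≤ m := by exact_mod_cast hm
  have hp' : (0 : ℝ) < p := by exact_mod_cast hp
  have hr' : (0 : ℝ) < r := by exact_mod_cast hr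
  have hx' : (0 : ℝ) < x := by exact_mod_cast hx
  have hE : min 1 ((m : ℝ) / r) * N = min (N : ℝ) ((m * N) / r) := by
    rw [min_mul_of_nonneg _ _ (Nat.cast_nonneg N), one_mul]; congr 1; ring
  have hpx : (0 : ℝ) < p * x := by positivity
  have hBE : min (N : ℝ) ((m * N - p * x) / r) ≤ min (N : ℝ) ((m * N) / r) := by
    gcongr; linarith
  have hEA : min (N : ℝ) ((m * N) / r) ≤ min (N : ℝ) ((m * N + p * x) / r) := by
    gcongr; linarith
  have hAB : min (N : ℝ) ((m * N + p * x) / r)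
      ≤ min (N : ℝ) ((m * N - p * x) / r) + 2 * p / r * x := by
    have h0 : (0 : ℝ) ≤ 2 * p / r * x := by positivity
    rw [min_add]
    apply min_le_min
    · linarith
    · apply le_of_eq; field_simp; ring
  have hB0 := hβ.trans_le hB
  rw [hexSum_eq hr (hB0.le.trans (hBE.trans hEA)) hB0.le, rectSum, hE, apSymm]
  generalize min (N : ℝ) ((m * N - p * x) / r) = B at *
  generalize min (N : ℝ) ((m * N) / r) = E at *
  generalize min (N : ℝ) ((m * N + p * x) / r) = A at *
  have hE0 := hB0.trans_le hBE
  have hA0 := hE0.trans_le hEA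
  have e1 := apSum_estimate hm (κ * x) hB0 hBE
  have e2 := apSum_estimate hm (-(κ * x)) hE0 hEA
  have a1 := apSum_add (m := m) (ρ := κ * x) (Int.floor_nonneg.2 hB0.le) (Int.floor_mono hBE)
  have a2 := apSum_add (m := m) (ρ := -(κ * x)) (Int.floor_nonneg.2 hE0.le) (Int.floor_mono hEA)
  rw [← a1, ← a2]
  have hlog : Real.log (A / B) / m = Real.log (E / B) / m + Real.log (A / E) / m := by
    rw [Real.log_div hA0.ne' hB0.ne', Real.log_div hE0.ne' hB0.ne',
      Real.log_div hA0.ne' hE0.ne']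
    ring
  have i1 : 3 / B ≤ 3 / β := by gcongr
  have i2 : 3 / E ≤ 3 / β := by gcongr; exact hB.trans hBE
  have i3 : 6 / β = 3 / β + 3 / β := by ring
  have main : |(apSum m (κ * x) 0 ⌊B⌋
      - (apSum m (-(κ * x)) 0 ⌊E⌋ + apSum m (-(κ * x)) ⌊E⌋ ⌊A⌋)
      - (apSum m (κ * x) 0 ⌊B⌋ + apSum m (κ * x) ⌊B⌋ ⌊E⌋ - apSum m (-(κ * x)) 0 ⌊E⌋))
      + Real.log (A / B) / m| ≤ 6 / β := by
    rw [hlog]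
    rw [abs_le] at *
    constructor <;> linarith [e1.1, e1.2, e2.1, e2.2]
  refine ⟨main, ?_⟩
  have hl0 : 0 ≤ Real.log (A / B) / m :=
    div_nonneg (Real.log_nonneg ((one_le_div hB0).2 (hBE.trans hEA))) hm'.le
  have hl1 : Real.log (A / B) / m ≤ 2 * p / r * x / β := by
    have hl : Real.log (A / B) ≤ 2 * p / r * x / β := by
      calc Real.log (A / B) ≤ A / B - 1 := Real.log_le_sub_one_of_pos (by positivity)
        _ = (A - B) / B := by field_simp
        _ ≤ (2 * p / r * x) / β := by gcongr; linarith
    have : 0 ≤ 2 * p / r * x / β := by positivity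
    calc Real.log (A / B) / m ≤ (2 * p / r * x / β) / m := by gcongr
      _ ≤ _ := div_le_self this hm1
  rw [add_div]
  rw [abs_le] at *
  constructor <;> linarith [main.1, main.2]

lemma abs_sum_inv_le (N : ℕ) (b : ℤ) (hb : b ≤ N) (P : ℤ → Prop) [DecidablePred P] :
    |∑ y ∈ Finset.Icc (-b) b with P y, (y : ℝ)⁻¹| ≤ 2 * N + 1 := by
  calc |∑ y ∈ Finset.Icc (-b) b with P y, (y : ℝ)⁻¹|
      ≤ ∑ y ∈ Finset.Icc (-b) b with P y, |(y : ℝ)⁻¹| := Finset.abs_sum_le_sum_abs _ _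
    _ ≤ ∑ y ∈ Finset.Icc (-b) b with P y, 1 := by
        apply Finset.sum_le_sum
        intro y _
        rcases eq_or_ne y 0 with rfl | hy
        · simp
        · rw [abs_inv]
          apply inv_le_one_of_one_le₀
          exact_mod_cast Int.one_le_abs hy
    _ ≤ ((Finset.Icc (-b) b).card : ℝ) := by
        rw [Finset.sum_const, nsmul_one]
        exact_mod_cast Finset.card_filter_le _ _
    _ ≤ 2 * N + 1 := by
        rw [Int.card_Icc]
        have : (b + 1 - -b).toNat ≤ 2 * N + 1 := by omega
        exact_mod_cast this

lemma abs_hexSum_sub_rectSum_le {m κ r : ℤ} (hm : 0 < m) (hr : 0 < r) (p : ℤ) (N : ℕ) (x : ℤ) :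
    |hexSum m κ p r N x - rectSum m κ r N x| ≤ 4 * N + 2 := by
  have hr' : (0 : ℝ) < r := by exact_mod_cast hr
  have hm' : (0 : ℝ) < m := by exact_mod_cast hm
  have h1 : |hexSum m κ p r N x| ≤ 2 * N + 1 := abs_sum_inv_le N N le_rfl _
  have h2 : |rectSum m κ r N x| ≤ 2 * N + 1 := by
    have h0 : (0 : ℝ) ≤ min 1 ((m : ℝ) / r) * N := by positivity
    rw [rectSum, apSymm_eq _ _ (Int.floor_nonneg.2 h0)]
    apply abs_sum_inv_le
    have : min 1 ((m : ℝ) / r) * N ≤ N :=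
      mul_le_of_le_one_left (Nat.cast_nonneg N) (min_le_left _ _)
    have := Int.floor_mono this
    simpa using this
  rw [abs_le] at *
  constructor <;> linarith [h1.1, h1.2, h2.1, h2.2]

lemma tendsto_ceil_nat_mul_div {t : ℝ} (ht : 0 < t) :
    Tendsto (fun N : ℕ => (⌈(N : ℝ) * t⌉₊ : ℝ) / N) atTop (𝓝 t) := by
  have := (tendsto_nat_ceil_mul_div_atTop ht.le).comp (tendsto_natCast_atTop_atTop (R := ℝ))
  refine this.congr fun N => ?_
  simp [mul_comm]

lemma tendsto_ceil_nat_mul {t : ℝ} (ht : 0 < t) :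
    Tendsto (fun N : ℕ => (⌈(N : ℝ) * t⌉₊ : ℝ)) atTop atTop := by
  apply tendsto_atTop_mono (fun N => Nat.le_ceil _)
  exact (tendsto_natCast_atTop_atTop (R := ℝ)).atTop_mul_const ht

/-- The difference between hexagon and rectangle converges, weights `x⁻¹`. -/
lemma exists_tendsto_diff_one {m κ p r : ℤ} (hm : 0 < m) (hp : 0 < p) (hr : 0 < r) (hpm : p < m) :
    ∃ L, Tendsto (fun N : ℕ => ∑ x ∈ Finset.Ioc 0 N,
      ((x : ℝ) ^ 1)⁻¹ * (hexSum m κ p r N x - rectSum m κ r N x)) atTop (𝓝 L) := by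
  have hm' : (0 : ℝ) < m := by exact_mod_cast hm
  have hp' : (0 : ℝ) < p := by exact_mod_cast hp
  have hr' : (0 : ℝ) < r := by exact_mod_cast hr
  have hpm' : (p : ℝ) < m := by exact_mod_cast hpm
  -- As `p < m`, the upper bound for `y` stays at least `c N` for every `x ≤ N`.
  set c : ℝ := min 1 ((m - p) / r) with hc
  have hc0 : 0 < c := lt_min one_pos (div_pos (by linarith) hr')
  have hB : ∀ N x : ℕ, x ≤ N → c * N ≤ min (N : ℝ) ((m * N - p * (x : ℤ)) / r) := by
    intro N x hxN
    have hxN' : (x : ℝ) ≤ N := by exact_mod_cast hxN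
    rw [hc, min_mul_of_nonneg _ _ (Nat.cast_nonneg N), one_mul]
    apply min_le_min le_rfl
    rw [div_mul_eq_mul_div]
    push_cast
    gcongr
    nlinarith
  refine ⟨_, tendsto_sum_Ioc_of_rescaled (C := (6 + 2 * p / r) / c)
    (ψ := fun t => t⁻¹ * (-(Real.log (min 1 ((m + p * t) / r) / min 1 ((m - p * t) / r)) / m)))
    ?_ ?_⟩
  · intro N x hx hxN
    have hN : (0 : ℝ) < N := by exact_mod_cast (by omega : 0 < N)
    have hx1 : (1 : ℝ) ≤ x := by exact_mod_cast hx
    have h := (hexSum_sub_rectSum_estimate (κ := κ) hm hp hr (x := x) (by exact_mod_cast hx)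
      (mul_pos hc0 hN) (hB N x hxN)).2
    rw [pow_one, abs_mul, abs_mul, Nat.abs_cast, abs_of_pos (by positivity : (0 : ℝ) < (x : ℝ)⁻¹)]
    calc (N : ℝ) * ((x : ℝ)⁻¹ * |hexSum m κ p r N x - rectSum m κ r N x|)
        ≤ N * ((x : ℝ)⁻¹ * ((6 + 2 * p / r * (x : ℤ)) / (c * N))) := by gcongr
      _ ≤ N * ((x : ℝ)⁻¹ * ((6 * x + 2 * p / r * (x : ℤ)) / (c * N))) := by
          gcongr; linarith
      _ = (6 + 2 * p / r) / c := by
          push_cast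
          field_simp
  · intro t ht ht1
    have hdiv := tendsto_ceil_nat_mul_div ht
    have hα : 0 < min 1 ((m + p * t) / r) := by positivity
    have hβ : 0 < min 1 ((m - p * t) / r) :=
      lt_min one_pos (div_pos (by nlinarith) hr')
    have hU : Tendsto (fun N : ℕ => hexSum m κ p r N (⌈(N : ℝ) * t⌉₊ : ℤ)
        - rectSum m κ r N (⌈(N : ℝ) * t⌉₊ : ℤ)) atTop
        (𝓝 (-(Real.log (min 1 ((m + p * t) / r) / min 1 ((m - p * t) / r)) / m))) := by
      -- Both bounds for `y` are `N` times a continuous function of `x / N`, and `x / N` tends to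
      -- `t`.
      have hlog : Tendsto (fun N : ℕ =>
          Real.log (min (N : ℝ) ((m * N + p * (⌈(N : ℝ) * t⌉₊ : ℤ)) / r)
            / min (N : ℝ) ((m * N - p * (⌈(N : ℝ) * t⌉₊ : ℤ)) / r)) / m) atTop
          (𝓝 (Real.log (min 1 ((m + p * t) / r) / min 1 ((m - p * t) / r)) / m)) := by
        apply Tendsto.div_const
        have h1 : Tendsto (fun N : ℕ => min (1 : ℝ) ((m + p * ((⌈(N : ℝ) * t⌉₊ : ℝ) / N)) / r)
            / min 1 ((m - p * ((⌈(N : ℝ) * t⌉₊ : ℝ) / N)) / r)) atTop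
            (𝓝 (min 1 ((m + p * t) / r) / min 1 ((m - p * t) / r))) := by
          apply Tendsto.div _ _ hβ.ne'
          · exact tendsto_const_nhds.min (((hdiv.const_mul _).const_add _).div_const _)
          · exact tendsto_const_nhds.min (((hdiv.const_mul _).const_sub _).div_const _)
        refine (h1.log (div_pos hα hβ).ne').congr' ?_
        filter_upwards [eventually_gt_atTop 0] with N hN
        have hN' : (0 : ℝ) < N := by exact_mod_cast hN
        congr 1
        rw [← mul_div_mul_right _ _ hN'.ne', min_mul_of_nonneg _ _ hN'.le,
          min_mul_of_nonneg _ _ hN'.le]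
        congr 2 <;> first | exact one_mul _ | (push_cast; field_simp)
      have hz : Tendsto (fun N : ℕ => 6 / (c * (N : ℝ))) atTop (𝓝 0) :=
        ((tendsto_natCast_atTop_atTop (R := ℝ)).const_mul_atTop hc0).const_div_atTop 6
      have hsum := squeeze_zero_norm' (a := fun N : ℕ => 6 / (c * (N : ℝ)))
        (f := fun N : ℕ => hexSum m κ p r N (⌈(N : ℝ) * t⌉₊ : ℤ)
          - rectSum m κ r N (⌈(N : ℝ) * t⌉₊ : ℤ)
          + Real.log (min (N : ℝ) ((m * N + p * (⌈(N : ℝ) * t⌉₊ : ℤ)) / r)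
            / min (N : ℝ) ((m * N - p * (⌈(N : ℝ) * t⌉₊ : ℤ)) / r)) / m) (t₀ := atTop) (by
        filter_upwards [eventually_gt_atTop 0] with N hN
        have hN' : (0 : ℝ) < N := by exact_mod_cast hN
        refine (hexSum_sub_rectSum_estimate (κ := κ) hm hp hr (x := ⌈(N : ℝ) * t⌉₊) ?_
          (mul_pos hc0 hN') (hB N _ ?_)).1
        · exact_mod_cast Nat.ceil_pos.2 (mul_pos hN' ht)
        · exact Nat.ceil_le.2 (by nlinarith)) hz
      have := hsum.sub hlog
      simpa using this
    have hinv := hdiv.inv₀ ht.ne'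
    refine (hinv.mul hU).congr fun N => ?_
    rw [inv_div, pow_one]
    ring

/-- The difference between hexagon and rectangle converges, weights `x⁻ᵃ` with `a ≥ 3`. -/
lemma exists_tendsto_diff_of_three_le {m κ p r : ℤ} (hm : 0 < m) (hp : 0 < p) (hr : 0 < r)
    {a : ℕ} (ha : 3 ≤ a) :
    ∃ L, Tendsto (fun N : ℕ => ∑ x ∈ Finset.Ioc 0 N,
      ((x : ℝ) ^ a)⁻¹ * (hexSum m κ p r N x - rectSum m κ r N x)) atTop (𝓝 L) := by
  have hm' : (0 : ℝ) < m := by exact_mod_cast hm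
  have hp' : (0 : ℝ) < p := by exact_mod_cast hp
  have hr' : (0 : ℝ) < r := by exact_mod_cast hr
  -- Here `p ≥ m` is possible, so the bound for `y` may degenerate for large `x`. While `2 p x ≤ m
  -- N` it is at least `c N`; beyond that, `N = O(x)` and the trivial bound `4 N + 2` is already
  -- `O(x² / N)`.
  set c : ℝ := min 1 (m / (2 * r)) with hc
  have hc0 : 0 < c := by positivity
  set C : ℝ := (6 + 2 * p / r) / c + 6 * (2 * p / m) ^ 2 with hC
  have hC0 : 0 ≤ C := by positivity
  have hU : ∀ N x : ℕ, 1 ≤ x → x ≤ N →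
      |hexSum m κ p r N x - rectSum m κ r N x| ≤ C * x ^ 2 / N := by
    intro N x hx hxN
    have hN1 : (1 : ℝ) ≤ N := by exact_mod_cast (by omega : 1 ≤ N)
    have hN : (0 : ℝ) < N := by linarith
    have hx1 : (1 : ℝ) ≤ x := by exact_mod_cast hx
    by_cases hxs : 2 * p * (x : ℝ) ≤ m * N
    · have hB : c * N ≤ min (N : ℝ) ((m * N - p * (x : ℤ)) / r) := by
        rw [hc, min_mul_of_nonneg _ _ (Nat.cast_nonneg N), one_mul]
        apply min_le_min le_rfl
        rw [le_div_iff₀ hr']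
        push_cast
        have : (m : ℝ) / (2 * r) * N * r = m * N / 2 := by field_simp
        rw [this]; linarith
      have h := (hexSum_sub_rectSum_estimate (κ := κ) hm hp hr (x := x) (by exact_mod_cast hx)
        (mul_pos hc0 hN) hB).2
      calc _ ≤ (6 + 2 * p / r * (x : ℤ)) / (c * N) := h
        _ ≤ (6 * x ^ 2 + 2 * p / r * x ^ 2) / (c * N) := by
            push_cast
            gcongr <;> nlinarith
        _ = (6 + 2 * p / r) / c * x ^ 2 / N := by field_simp
        _ ≤ C * x ^ 2 / N := by gcongr; rw [hC]; linarith [sq_nonneg (2 * (p : ℝ) / m)]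
    · push Not at hxs
      have h1 : (N : ℝ) ≤ 2 * p / m * x := by
        rw [div_mul_eq_mul_div, le_div_iff₀ hm']; linarith
      calc _ ≤ 4 * (N : ℝ) + 2 := abs_hexSum_sub_rectSum_le hm hr p N x
        _ ≤ 6 * N := by linarith
        _ = 6 * (N : ℝ) ^ 2 / N := by field_simp
        _ ≤ 6 * (2 * p / m * x) ^ 2 / N := by gcongr
        _ = 6 * (2 * p / m) ^ 2 * x ^ 2 / N := by ring
        _ ≤ C * x ^ 2 / N := by
            gcongr; rw [hC]
            have : 0 ≤ (6 + 2 * (p : ℝ) / r) / c := by positivity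
            linarith
  have hF : ∀ N x : ℕ, 1 ≤ x → x ≤ N →
      |(N : ℝ) * (((x : ℝ) ^ a)⁻¹ * (hexSum m κ p r N x - rectSum m κ r N x))| ≤ C / x := by
    intro N x hx hxN
    have hN : (0 : ℝ) < N := by exact_mod_cast (by omega : 0 < N)
    have hx1 : (1 : ℝ) ≤ x := by exact_mod_cast hx
    rw [abs_mul, abs_mul, Nat.abs_cast, abs_of_pos (by positivity : (0 : ℝ) < ((x : ℝ) ^ a)⁻¹)]
    calc (N : ℝ) * (((x : ℝ) ^ a)⁻¹ * |hexSum m κ p r N x - rectSum m κ r N x|)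
        ≤ N * (((x : ℝ) ^ 3)⁻¹ * (C * x ^ 2 / N)) := by
          gcongr
          exact hU N x hx hxN
      _ = C / x := by field_simp
  refine ⟨_, tendsto_sum_Ioc_of_rescaled (C := C) (ψ := fun _ => 0) ?_ ?_⟩
  · intro N x hx hxN
    exact (hF N x hx hxN).trans (div_le_self hC0 (by exact_mod_cast hx))
  · intro t ht ht1
    apply squeeze_zero_norm' (a := fun N : ℕ => C / (⌈(N : ℝ) * t⌉₊ : ℝ))
    · filter_upwards [eventually_gt_atTop 0] with N hN
      have hN' : (0 : ℝ) < N := by exact_mod_cast hN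
      refine hF N _ ?_ ?_
      · exact Nat.one_le_iff_ne_zero.2 (Nat.ceil_pos.2 (mul_pos hN' ht)).ne'
      · exact Nat.ceil_le.2 (by nlinarith)
    · exact (tendsto_ceil_nat_mul ht).const_div_atTop C

lemma apSum_congr {m ρ ρ' : ℤ} (h : ρ ≡ ρ' [ZMOD m]) (a b : ℤ) : apSum m ρ a b = apSum m ρ' a b := by
  unfold apSum
  congr 1
  ext y
  simp only [Finset.mem_filter, and_congr_right_iff]
  exact fun _ => ⟨fun hy => hy.trans h, fun hy => hy.trans h.symm⟩

lemma apSymm_congr {m ρ ρ' : ℤ} (h : ρ ≡ ρ' [ZMOD m]) (b : ℤ) : apSymm m ρ b = apSymm m ρ' b := by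
  rw [apSymm, apSymm, apSum_congr h, apSum_congr h.neg]

lemma exists_tendsto_sum_inv_pow_modEq {m : ℤ} (hm : 0 < m) (ρ : ℤ) {a : ℕ} (ha : 0 < a) :
    ∃ L, Tendsto (fun N : ℕ => ∑ x ∈ Finset.Icc (-(N : ℤ)) N with x ≡ ρ [ZMOD m],
      ((x : ℝ) ^ a)⁻¹) atTop (𝓝 L) := by
  rcases Nat.lt_or_ge 1 a with h | h
  · have hs : Summable (fun x : ℤ => ((x : ℝ) ^ a)⁻¹) := by
      simpa using Real.summable_one_div_int_pow.2 h
    refine ⟨_, ((hs.indicator {x | x ≡ ρ [ZMOD m]}).hasSum.comp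
      (Finset.tendsto_Icc_neg (R := ℤ))).congr fun N => ?_⟩
    simp only [Function.comp, Finset.sum_filter]
    apply Finset.sum_congr rfl
    intro x _
    simp [Set.indicator_apply]
  · obtain rfl : a = 1 := by omega
    obtain ⟨L, hL⟩ := exists_tendsto_apSymm hm ρ
    refine ⟨L, (hL.comp (tendsto_natCast_atTop_atTop (R := ℝ))).congr fun N => ?_⟩
    simp [apSymm_eq m ρ (Int.natCast_nonneg N)]

/-- The inner sum depends on `x` only through its class modulo `m`, so grouping by classes gives
finitely many products of one-dimensional sums. -/
lemma exists_tendsto_rect {m r : ℤ} (κ : ℤ) (hm : 0 < m) (hr : 0 < r) {a : ℕ} (ha : 0 < a) :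
    ∃ L, Tendsto (fun N : ℕ => ∑ x ∈ Finset.Icc (-(N : ℤ)) N,
      ((x : ℝ) ^ a)⁻¹ * rectSum m κ r N x) atTop (𝓝 L) := by
  have hm' : (0 : ℝ) < m := by exact_mod_cast hm
  have hr' : (0 : ℝ) < r := by exact_mod_cast hr
  choose L hL using fun ρ => exists_tendsto_sum_inv_pow_modEq hm ρ ha
  choose L' hL' using exists_tendsto_apSymm hm
  refine ⟨∑ ρ ∈ Finset.Ico 0 m, L ρ * L' (κ * ρ), ?_⟩
  have hto : Tendsto (fun N : ℕ => min 1 ((m : ℝ) / r) * N) atTop atTop :=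
    (tendsto_natCast_atTop_atTop (R := ℝ)).const_mul_atTop (by positivity)
  refine (tendsto_finsetSum (Finset.Ico 0 m) fun ρ _ =>
    (hL ρ).mul ((hL' (κ * ρ)).comp hto)).congr fun N => ?_
  rw [← Finset.sum_fiberwise_of_maps_to (s := Finset.Icc (-(N : ℤ)) N)
    (g := fun x => x % m) (t := Finset.Ico 0 m)
    (fun x _ => Finset.mem_Ico.2 ⟨Int.emod_nonneg x hm.ne', Int.emod_lt_of_pos x hm⟩)]
  apply Finset.sum_congr rfl
  intro ρ hρ
  rw [Finset.mem_Ico] at hρ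
  rw [Finset.sum_mul]
  have hiff : ∀ x : ℤ, x ≡ ρ [ZMOD m] ↔ x % m = ρ := fun x => by
    rw [Int.ModEq, Int.emod_eq_of_lt hρ.1 hρ.2]
  simp only [hiff]
  apply Finset.sum_congr rfl
  intro x hx
  rw [Finset.mem_filter, ← hiff] at hx
  rw [rectSum, Function.comp, apSymm_congr (hx.2.symm.mul_left κ)]

/-- Hexagonal partial sums of `∑ x⁻ᵃ y⁻¹` over the lattice `y ≡ κ x` modulo `m` converge, for odd
`a`, if `a ≥ 3` or if the hexagon `|x|, |y| ≤ N`, `|p x + r y| ≤ m N` meets the line `y = 0` only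
in the side `|x| = N`. -/
lemma exists_tendsto_hex {m p r : ℤ} (κ : ℤ) (hm : 0 < m) (hp : 0 < p) (hr : 0 < r) {a : ℕ}
    (ha : Odd a) (h : 3 ≤ a ∨ p < m) :
    ∃ L, Tendsto (fun N : ℕ => ∑ x ∈ Finset.Icc (-(N : ℤ)) N,
      ((x : ℝ) ^ a)⁻¹ * hexSum m κ p r N x) atTop (𝓝 L) := by
  obtain ⟨L, hL⟩ := exists_tendsto_rect κ hm hr ha.pos
  have hD : ∃ L, Tendsto (fun N : ℕ => ∑ x ∈ Finset.Ioc 0 N,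
      ((x : ℝ) ^ a)⁻¹ * (hexSum m κ p r N x - rectSum m κ r N x)) atTop (𝓝 L) := by
    by_cases h3 : 3 ≤ a
    · exact exists_tendsto_diff_of_three_le hm hp hr h3
    · obtain rfl : a = 1 := by obtain ⟨b, rfl⟩ := ha; omega
      exact exists_tendsto_diff_one hm hp hr (by omega)
  obtain ⟨D, hD⟩ := hD
  refine ⟨L + 2 * D, (hL.add (hD.const_mul 2)).congr fun N => ?_⟩
  -- For odd `a` both factors are odd in `x`, so the difference over all `x` is twice that over `x >
  -- 0`; the term `x = 0` vanishes.
  have heven : Function.Even (fun x : ℤ =>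
      ((x : ℝ) ^ a)⁻¹ * (hexSum m κ p r N x - rectSum m κ r N x)) := by
    intro x
    simp only [hexSum_neg, rectSum_neg, Int.cast_neg, ha.neg_pow, inv_neg]
    ring
  have hs := Finset.sum_Icc_of_even_eq_range heven N
  simp only [mul_sub, Finset.sum_sub_distrib] at hs ⊢
  have h0 : ∀ f : ℕ → ℝ, f 0 = 0 → ∑ x ∈ Finset.range (N + 1), f x = ∑ x ∈ Finset.Ioc 0 N, f x := by
    intro f hf
    rw [Finset.sum_range_succ', hf, add_zero, Finset.range_eq_Ico,
      Finset.sum_Ico_add' (fun k => f k) 0 N 1]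
    rfl
  rw [h0 _ (by simp [ha.pos.ne']), h0 _ (by simp [ha.pos.ne'])] at hs
  simp only [Int.cast_natCast, Int.cast_zero, zero_pow ha.pos.ne', inv_zero, zero_mul, sub_zero,
    two_smul] at hs
  linarith

/-! ### Existence of the principal values of `Y` -/

namespace ConicalReciprocity

/-- The integer vectors orthogonal to `c`. -/
def lat (c : Fin 3 → ℤ) : Set (Fin 3 → ℤ) := {n | ∑ j, c j * n j = 0}

lemma mem_boxed {S : Set (Fin 3 → ℤ)} {N : ℕ} {n : Fin 3 → ℤ} :
    n ∈ boxed S N ↔ (∀ j, -(N : ℤ) ≤ n j ∧ n j ≤ N) ∧ n ∈ S := by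
  classical
  simp [boxed, Fintype.mem_piFinset]

lemma tendsto_partialSum {S : Set (Fin 3 → ℤ)} {e : Fin 3 → ℕ}
    (h : Summable fun n : S => invPow n e) :
    Tendsto (partialSum S e) atTop (𝓝 (∑' n : S, invPow n e)) := by
  classical
  have hs : HasSum (S.indicator fun n => invPow n e) (∑' n : S, invPow n e) :=
    hasSum_subtype_iff_indicator.1 h.hasSum
  have hbox : Tendsto (fun N : ℕ => boxed Set.univ N) atTop atTop := by
    apply tendsto_atTop_finset_of_monotone
    · intro M N hMN n
      simp only [mem_boxed]
      have : (M : ℤ) ≤ N := by exact_mod_cast hMN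
      exact fun hn => ⟨fun j => ⟨by linarith [(hn.1 j).1], by linarith [(hn.1 j).2]⟩, hn.2⟩
    · intro n
      refine ⟨∑ j, (n j).natAbs, ?_⟩
      rw [mem_boxed]
      refine ⟨fun j => ?_, trivial⟩
      have : (n j).natAbs ≤ ∑ j, (n j).natAbs :=
        Finset.single_le_sum (f := fun j => (n j).natAbs) (fun _ _ => Nat.zero_le _)
          (Finset.mem_univ j)
      omega
  refine (hs.comp hbox).congr fun N => ?_
  simp only [Function.comp]
  rw [Finset.sum_indicator_eq_sum_filter, partialSum]
  congr 1
  ext n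
  simp [mem_boxed]

section

variable {i j k : Fin 3}

lemma sum_fin_three_of_ne (hij : i ≠ j) (hik : i ≠ k) (hjk : j ≠ k) {M : Type*} [AddCommMonoid M]
    (f : Fin 3 → M) : ∑ t, f t = f i + f j + f k := by
  have h : (Finset.univ : Finset (Fin 3)) = {i, j, k} := by
    revert i j k; decide
  rw [h, Finset.sum_insert (by simp [hij, hik]), Finset.sum_insert (by simp [hjk]),
    Finset.sum_singleton, add_assoc]

lemma invPow_dropAt (hij : i ≠ j) (hik : i ≠ k) (hjk : j ≠ k) (n : Fin 3 → ℤ) (q : Fin 3 → ℕ) :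
    invPow n (dropAt q k) = ((n i : ℝ) ^ q i)⁻¹ * ((n j : ℝ) ^ q j)⁻¹ := by
  have h : (Finset.univ : Finset (Fin 3)) = {i, j, k} := by
    revert i j k; decide
  rw [invPow, h, Finset.prod_insert (by simp [hij, hik]), Finset.prod_insert (by simp [hjk]),
    Finset.prod_singleton]
  simp [dropAt, Function.update_of_ne hik, Function.update_of_ne hjk]

lemma eq_or_eq_or_eq (hij : i ≠ j) (hik : i ≠ k) (hjk : j ≠ k) (t : Fin 3) :
    t = i ∨ t = j ∨ t = k := by
  revert i j k t; decide

lemma lat_ext (hij : i ≠ j) (hik : i ≠ k) (hjk : j ≠ k) {c : Fin 3 → ℤ} (hc : c k ≠ 0)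
    {n n' : Fin 3 → ℤ} (hn : n ∈ lat c) (hn' : n' ∈ lat c) (hi : n i = n' i) (hj : n j = n' j) :
    n = n' := by
  simp only [lat, Set.mem_ofPred_eq, sum_fin_three_of_ne hij hik hjk] at hn hn'
  have hk : n k = n' k := by
    apply mul_left_cancel₀ hc
    rw [hi, hj] at hn
    linarith
  funext t
  rcases eq_or_eq_or_eq hij hik hjk t with rfl | rfl | rfl <;> assumption

lemma summable_invPow_of_two_le (hij : i ≠ j) (hik : i ≠ k) (hjk : j ≠ k) {c : Fin 3 → ℤ}
    (hc : c k ≠ 0) {q : Fin 3 → ℕ} (hi : 2 ≤ q i) (hj : 2 ≤ q j) {S : Set (Fin 3 → ℤ)}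
    (hS : S ⊆ lat c) : Summable fun n : S => invPow n (dropAt q k) := by
  have hs : ∀ a : ℕ, 2 ≤ a → Summable (fun x : ℤ => |((x : ℝ) ^ a)⁻¹|) := fun a ha => by
    simpa using (Real.summable_one_div_int_pow.2 (show 1 < a by omega)).abs
  have h2 := (hs _ hi).mul_of_nonneg (hs _ hj) (fun _ => abs_nonneg _) (fun _ => abs_nonneg _)
  have hinj : Function.Injective (fun n : S => ((n : Fin 3 → ℤ) i, (n : Fin 3 → ℤ) j)) := by
    intro n n' h
    simp only [Prod.mk.injEq] at h
    exact Subtype.ext (lat_ext hij hik hjk hc (hS n.2) (hS n'.2) h.1 h.2)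
  apply Summable.of_abs
  refine (h2.comp_injective hinj).congr fun n => ?_
  simp [invPow_dropAt hij hik hjk, abs_mul]

/-- When `n k = 0`, the coordinates `n i` and `n j` are proportional, so the terms are `O(1 / (n
i)²)` even with both exponents equal to `1`. -/
lemma summable_invPow_of_eq_zero (hij : i ≠ j) (hik : i ≠ k) (hjk : j ≠ k) {c : Fin 3 → ℤ}
    (hc : ∀ t, c t ≠ 0) {q : Fin 3 → ℕ} (hi : 0 < q i) (hj : 0 < q j) :
    Summable fun n : {n | n ∈ lat c ∧ n k = 0} => invPow n (dropAt q k) := by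
  have hs : Summable (fun x : ℤ => |(c j : ℝ)| * |((x : ℝ) ^ 2)⁻¹|) := by
    simpa using (Real.summable_one_div_int_pow.2 one_lt_two).mul_left |(c j : ℝ)|
  have hinj : Function.Injective
      (fun n : {n | n ∈ lat c ∧ n k = 0} => (n : Fin 3 → ℤ) i) := by
    intro n n' h
    exact Subtype.ext (lat_ext hik hij hjk.symm (hc j) n.2.1 n'.2.1 h (n.2.2.trans n'.2.2.symm))
  refine Summable.of_norm_bounded (hs.comp_injective hinj) fun n => ?_
  obtain ⟨n, hn, hk⟩ := n
  simp only [lat, Set.mem_ofPred_eq, sum_fin_three_of_ne hij hik hjk, hk, mul_zero, add_zero] at hn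
  simp only [invPow_dropAt hij hik hjk, Function.comp, Real.norm_eq_abs]
  rcases eq_or_ne (n i) 0 with h0 | h0
  · simp [h0, hi.ne']
  have hji : (c j : ℝ) * n j = -(c i * n i) := by
    have : c j * n j = -(c i * n i) := by linarith
    exact_mod_cast this
  have hn0 : n j ≠ 0 := by
    rintro h
    rw [h, mul_zero, add_zero] at hn
    exact (mul_ne_zero (hc i) h0) hn
  have one_le : ∀ z : ℤ, z ≠ 0 → (1 : ℝ) ≤ |(z : ℝ)| := fun z hz => by
    exact_mod_cast Int.one_le_abs hz
  have habs : |(n i : ℝ)| ≤ |(c j : ℝ)| * |(n j : ℝ)| := by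
    rw [← abs_mul, hji, abs_neg, abs_mul]
    exact le_mul_of_one_le_left (abs_nonneg _) (one_le _ (hc i))
  have hi1 := one_le _ h0
  have hj1 := one_le _ hn0
  rw [abs_mul, abs_inv, abs_inv, abs_inv, abs_pow, abs_pow, abs_pow]
  calc (|(n i : ℝ)| ^ q i)⁻¹ * (|(n j : ℝ)| ^ q j)⁻¹ ≤ (|(n i : ℝ)| ^ 1)⁻¹ * (|(n j : ℝ)| ^ 1)⁻¹ := by
        gcongr <;> assumption
    _ ≤ (|(n i : ℝ)| ^ 1)⁻¹ * (|(c j : ℝ)| * (|(n i : ℝ)|)⁻¹) := by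
        gcongr
        rw [pow_one, ← div_eq_mul_inv, le_div_iff₀ (by linarith), inv_mul_le_iff₀ (by linarith)]
        linarith
    _ = |(c j : ℝ)| * (|(n i : ℝ)| ^ 2)⁻¹ := by
        field_simp

/-- The hexagonal sum also sees lattice points with a zero coordinate. Those with `n i = 0` or `n j
= 0` contribute `0`; only those with `n k = 0` need correction. -/
lemma partialSum_lat (hij : i ≠ j) (hik : i ≠ k) (hjk : j ≠ k) {c : Fin 3 → ℤ} {q : Fin 3 → ℕ}
    (hi : 0 < q i) (hj : 0 < q j) (N : ℕ) :
    partialSum (lat c) (dropAt q k) N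
      = partialSum {n | n ∈ lat c ∧ ∀ t, n t ≠ 0} (dropAt q k) N
        + partialSum {n | n ∈ lat c ∧ n k = 0} (dropAt q k) N := by
  classical
  unfold partialSum
  rw [← Finset.sum_union]
  · symm
    apply Finset.sum_subset
    · intro n hn
      simp only [Finset.mem_union, mem_boxed] at hn ⊢
      rcases hn with hn | hn
      · exact ⟨hn.1, hn.2.1⟩
      · exact ⟨hn.1, hn.2.1⟩
    · intro n hn hn'
      simp only [Finset.mem_union, mem_boxed, Set.mem_ofPred_eq, not_or] at hn hn'
      rw [invPow_dropAt hij hik hjk]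
      by_contra h
      have h0i : n i ≠ 0 := by rintro h0; simp [h0, hi.ne'] at h
      have h0j : n j ≠ 0 := by rintro h0; simp [h0, hj.ne'] at h
      by_cases h0k : n k = 0
      · exact hn'.2 ⟨hn.1, hn.2, h0k⟩
      · refine hn'.1 ⟨hn.1, hn.2, fun t => ?_⟩
        rcases eq_or_eq_or_eq hij hik hjk t with rfl | rfl | rfl <;> assumption
  · rw [Finset.disjoint_left]
    intro n hn hn'
    exact (mem_boxed.1 hn).2.2 k (mem_boxed.1 hn').2.2

/-- Eliminating `n k`: its integrality is the congruence `y ≡ κ x`, and `|n k| ≤ N` gives the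
remaining two sides of the hexagon. -/
lemma partialSum_lat_eq_hex (hij : i ≠ j) (hik : i ≠ k) (hjk : j ≠ k) {c : Fin 3 → ℤ}
    (hc : 0 < c k) {q : Fin 3 → ℕ} (hj : q j = 1) {κ : ℤ}
    (hκ : ∀ x y : ℤ, c k ∣ c i * x + c j * y ↔ y ≡ κ * x [ZMOD c k]) (N : ℕ) :
    partialSum (lat c) (dropAt q k) N
      = ∑ x ∈ Finset.Icc (-(N : ℤ)) N,
          ((x : ℝ) ^ q i)⁻¹ * hexSum (c k) κ (c i) (c j) N x := by
  simp only [hexSum, Finset.mul_sum]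
  rw [Finset.sum_sigma', partialSum]
  have hlat : ∀ n : Fin 3 → ℤ, n ∈ lat c ↔ c i * n i + c j * n j = -(c k * n k) := fun n => by
    simp only [lat, Set.mem_ofPred_eq, sum_fin_three_of_ne hij hik hjk]
    constructor <;> intro h <;> linarith
  refine Finset.sum_bij' (fun n _ => ⟨n i, n j⟩)
    (fun s _ => fun t => if t = i then s.1 else if t = j then s.2
      else -((c i * s.1 + c j * s.2) / c k)) ?_ ?_ ?_ ?_ ?_
  · intro n hn
    rw [mem_boxed, hlat] at hn
    simp only [Finset.mem_sigma, Finset.mem_Icc, Finset.mem_filter, ← hκ]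
    refine ⟨hn.1 i, hn.1 j, ⟨-n k, by rw [hn.2]; ring⟩, ?_⟩
    rw [hn.2, abs_neg, abs_mul, abs_of_pos hc]
    exact mul_le_mul_of_nonneg_left (abs_le.2 (hn.1 k)) hc.le
  · rintro ⟨x, y⟩ hs
    simp only [Finset.mem_sigma, Finset.mem_Icc, Finset.mem_filter, ← hκ] at hs
    obtain ⟨hx, hy, ⟨z, hz⟩, hle⟩ := hs
    rw [hz, abs_mul, abs_of_pos hc] at hle
    have hle' := abs_le.1 (le_of_mul_le_mul_left hle hc)
    rw [mem_boxed, hlat]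
    refine ⟨fun t => ?_, ?_⟩
    · rcases eq_or_eq_or_eq hij hik hjk t with rfl | rfl | rfl
      · simpa using hx
      · simpa [hij.symm] using hy
      · simp only [hik.symm, hjk.symm, if_false, hz, Int.mul_ediv_cancel_left _ hc.ne']
        exact ⟨by linarith [hle'.2], by linarith [hle'.1]⟩
    · simp [hij.symm, hik.symm, hjk.symm, hz, Int.mul_ediv_cancel_left _ hc.ne']
  · intro n hn
    rw [mem_boxed, hlat] at hn
    funext t
    rcases eq_or_eq_or_eq hij hik hjk t with rfl | rfl | rfl
    · simp
    · simp [hij.symm]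
    · simp only [hik.symm, hjk.symm, if_false, hn.2]
      rw [← mul_neg, Int.mul_ediv_cancel_left _ hc.ne', neg_neg]
  · rintro ⟨x, y⟩ hs
    simp [hij.symm]
  · intro n hn
    simp [invPow_dropAt hij hik hjk, hj]

lemma perp_eq (ν : Fin 3 → ℕ) :
    perp ν = {n | n ∈ lat (fun t => (ν t : ℤ)) ∧ ∀ t, n t ≠ 0} := rfl

lemma exists_tendsto_YPartial_of_eq_one (hij : i ≠ j) (hik : i ≠ k) (hjk : j ≠ k)
    {ν q : Fin 3 → ℕ} (hν_pos : ∀ j, 0 < ν j)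
    (hν_coprime : Pairwise fun i j => Nat.Coprime (ν i) (ν j))
    (hi : Odd (q i)) (hj : q j = 1) (h : 3 ≤ q i ∨ ν i < ν k) :
    ∃ L, Tendsto (YPartial k ν q) atTop (𝓝 L) := by
  have hpos : ∀ t, 0 < (ν t : ℤ) := fun t => by exact_mod_cast hν_pos t
  have hκ : ∃ κ : ℤ, ∀ x y : ℤ, (ν k : ℤ) ∣ ν i * x + ν j * y ↔ y ≡ κ * x [ZMOD ν k] := by
    have hcop : IsCoprime (ν j : ℤ) (ν k : ℤ) := Nat.isCoprime_iff_coprime.2 (hν_coprime hjk)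
    obtain ⟨u, v, huv⟩ := hcop
    -- Since `u` inverts `ν j` modulo `ν k`, this is `-ν i / ν j` modulo `ν k`.
    refine ⟨-(u * ν i), fun x y => ?_⟩
    rw [Int.modEq_iff_dvd]
    constructor
    · rintro ⟨z, hz⟩
      refine ⟨-u * z - v * y, ?_⟩
      linear_combination (-u) * hz + y * huv
    · rintro ⟨z, hz⟩
      refine ⟨- z * ν j + v * ν i * x, ?_⟩
      linear_combination (-ν j : ℤ) * hz - ν i * x * huv
  obtain ⟨κ, hκ⟩ := hκ
  obtain ⟨L, hL⟩ := exists_tendsto_hex (a := q i) κ (hpos k) (hpos i) (hpos j) hi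
    (h.imp_right fun h => by exact_mod_cast h)
  have h0 := tendsto_partialSum (summable_invPow_of_eq_zero hij hik hjk
    (c := fun t => (ν t : ℤ)) (fun t => (hpos t).ne') (q := q) hi.pos (by omega))
  refine ⟨_, (hL.sub h0).congr fun N => ?_⟩
  rw [YPartial, perp_eq, ← partialSum_lat_eq_hex (c := fun t => (ν t : ℤ)) hij hik hjk (hpos k) hj hκ,
    partialSum_lat hij hik hjk hi.pos (by omega)]
  ring

end

/-- The linear relation between the three sums with all exponents equal to one. -/
lemma sum_mul_YPartial_one (ν : Fin 3 → ℕ) (N : ℕ) :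
    ∑ k, (ν k : ℝ) * YPartial k ν (fun _ => 1) N = 0 := by
  simp only [YPartial, partialSum, Finset.mul_sum]
  rw [Finset.sum_comm]
  apply Finset.sum_eq_zero
  intro n hn
  obtain ⟨-, h, h0⟩ := mem_boxed.1 hn
  have hR : ∑ j, (ν j : ℝ) * n j = 0 := by exact_mod_cast h
  have h0' : ∀ j, (n j : ℝ) ≠ 0 := fun j => by exact_mod_cast h0 j
  rw [Fin.sum_univ_three] at hR ⊢
  rw [invPow_dropAt (i := 1) (j := 2) (k := 0) (by decide) (by decide) (by decide),
    invPow_dropAt (i := 0) (j := 2) (k := 1) (by decide) (by decide) (by decide),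
    invPow_dropAt (i := 0) (j := 1) (k := 2) (by decide) (by decide) (by decide)]
  have := h0' 0
  have := h0' 1
  have := h0' 2
  -- Each point contributes `(∑ ν_k n_k) / (n_0 n_1 n_2) = 0`.
  field_simp
  linarith

theorem exists_tendsto_YPartial {ν q : Fin 3 → ℕ} (hν_pos : ∀ j, 0 < ν j)
    (hν_inj : Function.Injective ν)
    (hν_coprime : Pairwise fun i j => Nat.Coprime (ν i) (ν j))
    (hq_pos : ∀ j, 0 < q j) (hq_even : Even (barWeight q)) {k : Fin 3} (hk : q k = 1) :
    ∃ L, Tendsto (YPartial k ν q) atTop (𝓝 L) := by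
  obtain ⟨i, j, hij, hik, hjk⟩ : ∃ i j : Fin 3, i ≠ j ∧ i ≠ k ∧ j ≠ k :=
    (by decide : ∀ k : Fin 3, ∃ i j : Fin 3, i ≠ j ∧ i ≠ k ∧ j ≠ k) k
  have heven : Even (q i + q j) := by
    have : barWeight q = q i + q j := by
      rw [barWeight, sum_fin_three_of_ne hij hik hjk, hk]; rfl
    rwa [this] at hq_even
  rw [Nat.even_iff] at heven
  have hqi := hq_pos i
  have hqj := hq_pos j
  by_cases hi : q i = 1
  · by_cases hj : q j = 1
    · have hq : q = fun _ => 1 := by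
        funext t
        rcases eq_or_eq_or_eq hij hik hjk t with rfl | rfl | rfl <;> assumption
      subst hq
      have key : ∀ k i : Fin 3, i ≠ k → ν i < ν k →
          ∃ L, Tendsto (YPartial k ν fun _ => 1) atTop (𝓝 L) := by
        intro k i hik h
        obtain ⟨j, hij, hjk⟩ : ∃ j, i ≠ j ∧ j ≠ k :=
          (by decide : ∀ k i : Fin 3, ∃ j, i ≠ j ∧ j ≠ k) k i
        exact exists_tendsto_YPartial_of_eq_one hij hik hjk hν_pos hν_coprime odd_one rfl (.inr h)
      rcases lt_or_gt_of_ne (hν_inj.ne hik) with h | h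
      · exact key k i hik h
      rcases lt_or_gt_of_ne (hν_inj.ne hjk) with h' | h'
      · exact key k j hjk h'
      -- Now `ν k` is the least entry, where the hexagon argument fails; the other two limits exist
      -- and the linear relation determines this one.
      obtain ⟨Li, hLi⟩ := key i k hik.symm h
      obtain ⟨Lj, hLj⟩ := key j k hjk.symm h'
      refine ⟨_, (((hLi.const_mul (ν i : ℝ)).add (hLj.const_mul (ν j : ℝ))).neg.div_const
        (ν k : ℝ)).congr fun N => ?_⟩
      have := sum_mul_YPartial_one ν N
      rw [sum_fin_three_of_ne hij hik hjk] at this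
      have hk0 : (ν k : ℝ) ≠ 0 := by exact_mod_cast (hν_pos k).ne'
      rw [div_eq_iff hk0]
      linarith
    · exact exists_tendsto_YPartial_of_eq_one hij.symm hjk hik hν_pos hν_coprime
        (Nat.odd_iff.2 (by omega)) hi (.inl (by omega))
  · by_cases hj : q j = 1
    · exact exists_tendsto_YPartial_of_eq_one hij hik hjk hν_pos hν_coprime
        (Nat.odd_iff.2 (by omega)) hj (.inl (by omega))
    · exact ⟨_, tendsto_partialSum (summable_invPow_of_two_le hij hik hjk
        (c := fun t => (ν t : ℤ)) (by exact_mod_cast (hν_pos k).ne') (by omega) (by omega)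
        (fun n hn => hn.1))⟩

/-! ### Reduction to primitive points -/

/-- A convolution of Tannery type: `∑ c_d g(⌊N / d⌋)` converges to `(∑ c_d) (lim g)`. -/
lemma tendsto_sum_mul_div {c g : ℕ → ℝ} {L : ℝ} (hc : Summable c) (hg : Tendsto g atTop (𝓝 L))
    (hg0 : g 0 = 0) (hc0 : c 0 = 0) :
    Tendsto (fun N : ℕ => ∑ d ∈ Finset.Icc 1 N, c d * g (N / d)) atTop (𝓝 ((∑' d, c d) * L)) := by
  obtain ⟨C, hC⟩ := (Metric.isBounded_range_of_tendsto g hg).exists_norm_le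
  rw [← tsum_mul_right]
  -- The sum extends to all `d`: for `d > N` the quotient is `0` and `g 0 = 0`, while `c 0 = 0`
  -- removes `d = 0`, where `N / 0 = 0` would not tend to infinity. As `g` is bounded, `|c_d| C`
  -- dominates.
  have key := tendsto_tsum_of_dominated_convergence (𝓕 := atTop)
    (f := fun (N d : ℕ) => c d * g (N / d)) (g := fun d => c d * L) (bound := fun d => |c d| * C)
    (hc.abs.mul_right C) (fun d => by
      rcases Nat.eq_zero_or_pos d with rfl | hd
      · simp [hc0]
      · exact (hg.comp (Nat.tendsto_div_const_atTop hd.ne')).const_mul _)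
    (Eventually.of_forall fun N d => by
      rw [norm_mul, Real.norm_eq_abs]
      exact mul_le_mul_of_nonneg_left (hC _ ⟨_, rfl⟩) (abs_nonneg _))
  refine key.congr fun N => ?_
  apply tsum_eq_sum
  intro d hd
  rcases Nat.eq_zero_or_pos d with rfl | hd0
  · simp [hc0]
  · rw [Finset.mem_Icc, not_and, not_le] at hd
    simp [Nat.div_eq_of_lt (hd hd0), hg0]

lemma gcd_eq_one_iff {n : Fin 3 → ℤ} :
    Finset.univ.gcd n = 1 ↔ ∀ d : ℤ, (∀ j, d ∣ n j) → d ∣ 1 := by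
  constructor
  · intro h d hd
    rw [← h]
    exact Finset.dvd_gcd fun j _ => hd j
  · intro h
    have := h _ fun j => Finset.gcd_dvd (Finset.mem_univ j)
    rw [← Finset.normalize_gcd]
    exact normalize_eq_one.2 (isUnit_of_dvd_one this)

lemma mem_boxed_natAbs {S : Set (Fin 3 → ℤ)} {N : ℕ} {n : Fin 3 → ℤ} :
    n ∈ boxed S N ↔ (∀ j, (n j).natAbs ≤ N) ∧ n ∈ S := by
  rw [mem_boxed]
  refine and_congr_left fun _ => forall_congr' fun j => ?_
  omega

lemma invPow_mul (d : ℤ) (n : Fin 3 → ℤ) (e : Fin 3 → ℕ) :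
    invPow (fun j => d * n j) e = ((d : ℝ) ^ (∑ j, e j))⁻¹ * invPow n e := by
  simp only [invPow, Int.cast_mul, mul_pow, mul_inv, Finset.prod_mul_distrib]
  rw [← Finset.prod_pow_eq_pow_sum, Finset.prod_inv_distrib]

open scoped Classical in
/-- Scaling of symmetric partial sums. -/
lemma sum_boxed_filter_eq {S T : Set (Fin 3 → ℤ)} {P : (Fin 3 → ℤ) → Prop} {d : ℕ} (hd : 0 < d)
    (h : ∀ n, n ∈ S ∧ P n ↔ ∃ n' ∈ T, n = fun j => (d : ℤ) * n' j) (e : Fin 3 → ℕ) (N : ℕ) :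
    ∑ n ∈ boxed S N with P n, invPow n e
      = ((d : ℝ) ^ (∑ j, e j))⁻¹ * partialSum T e (N / d) := by
  rw [partialSum, Finset.mul_sum]
  symm
  refine Finset.sum_nbij (fun n => fun j => (d : ℤ) * n j) ?_ ?_ ?_ ?_
  · intro n hn
    rw [mem_boxed_natAbs] at hn
    have h2 := (h _).2 ⟨n, hn.2, rfl⟩
    rw [Finset.mem_filter, mem_boxed_natAbs]
    refine ⟨⟨fun j => ?_, h2.1⟩, h2.2⟩
    rw [Int.natAbs_mul, Int.natAbs_natCast, mul_comm]
    exact (Nat.le_div_iff_mul_le hd).1 (hn.1 j)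
  · intro n _ n' _ hnn'
    funext j
    have := congrFun hnn' j
    exact mul_left_cancel₀ (by exact_mod_cast hd.ne') this
  · intro n hn
    rw [Finset.mem_coe, Finset.mem_filter, mem_boxed_natAbs] at hn
    obtain ⟨n', hn', rfl⟩ := (h n).1 ⟨hn.1.2, hn.2⟩
    refine ⟨n', ?_, rfl⟩
    rw [Finset.mem_coe, mem_boxed_natAbs]
    refine ⟨fun j => ?_, hn'⟩
    have := hn.1.1 j
    rw [Int.natAbs_mul, Int.natAbs_natCast, mul_comm] at this
    exact (Nat.le_div_iff_mul_le hd).2 this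
  · intro n _
    rw [invPow_mul]
    simp

/-- The primitive points of `perp ν`. -/
def primPerp (ν : Fin 3 → ℕ) : Set (Fin 3 → ℤ) := {n | n ∈ perp ν ∧ Finset.univ.gcd n = 1}

lemma mul_mem_perp {ν : Fin 3 → ℕ} {d : ℤ} (hd : d ≠ 0) {n : Fin 3 → ℤ} :
    (fun j => d * n j) ∈ perp ν ↔ n ∈ perp ν := by
  have : ∑ j, (ν j : ℤ) * (d * n j) = d * ∑ j, (ν j : ℤ) * n j := by
    rw [Finset.mul_sum]; exact Finset.sum_congr rfl fun j _ => by ring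
  simp [perp, this, hd]

lemma natAbs_gcd_eq_iff {ν : Fin 3 → ℕ} {d : ℕ} (hd : 0 < d) (n : Fin 3 → ℤ) :
    n ∈ perp ν ∧ (Finset.univ.gcd n).natAbs = d ↔
      ∃ n' ∈ primPerp ν, n = fun j => (d : ℤ) * n' j := by
  have hd' : (d : ℤ) ≠ 0 := by exact_mod_cast hd.ne'
  constructor
  · rintro ⟨hn, h⟩
    obtain ⟨g, hg, hg1⟩ := Finset.extract_gcd n Finset.univ_nonempty
    have hgd : Finset.univ.gcd n = d := by
      rw [← h, Int.natCast_natAbs, Int.abs_eq_normalize, Finset.normalize_gcd]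
    have hn' : n = fun j => (d : ℤ) * g j := by
      funext j
      rw [hg j (Finset.mem_univ j), hgd]
    exact ⟨g, ⟨(mul_mem_perp hd').1 (hn' ▸ hn), hg1⟩, hn'⟩
  · rintro ⟨n', ⟨hn', h1⟩, rfl⟩
    refine ⟨(mul_mem_perp hd').2 hn', ?_⟩
    rw [Finset.gcd_mul_left, h1, mul_one, ← Int.abs_eq_normalize]
    simp

lemma dvd_gcd_iff {ν : Fin 3 → ℕ} {d : ℕ} (hd : 0 < d) (n : Fin 3 → ℤ) :
    n ∈ perp ν ∧ d ∣ (Finset.univ.gcd n).natAbs ↔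
      ∃ n' ∈ perp ν, n = fun j => (d : ℤ) * n' j := by
  have hd' : (d : ℤ) ≠ 0 := by exact_mod_cast hd.ne'
  rw [← Int.natCast_dvd, Finset.dvd_gcd_iff]
  constructor
  · rintro ⟨hn, h⟩
    choose g hg using fun j => h j (Finset.mem_univ j)
    obtain rfl : n = fun j => (d : ℤ) * g j := funext hg
    exact ⟨g, (mul_mem_perp hd').1 hn, rfl⟩
  · rintro ⟨n', hn', rfl⟩
    exact ⟨(mul_mem_perp hd').2 hn', fun j _ => dvd_mul_right _ _⟩

lemma natAbs_gcd_mem {ν : Fin 3 → ℕ} {N : ℕ} {n : Fin 3 → ℤ} (hn : n ∈ boxed (perp ν) N) :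
    (Finset.univ.gcd n).natAbs ∈ Finset.Icc 1 N := by
  rw [mem_boxed_natAbs] at hn
  have h0 : n 0 ≠ 0 := hn.2.2 0
  have hdvd : Finset.univ.gcd n ∣ n 0 := Finset.gcd_dvd (Finset.mem_univ 0)
  rw [Finset.mem_Icc]
  constructor
  · rw [Nat.one_le_iff_ne_zero, Int.natAbs_ne_zero]
    rintro h
    exact h0 (by simpa [h] using hdvd)
  · exact (Nat.le_of_dvd (Int.natAbs_pos.2 h0) (Int.natAbs_dvd_natAbs.2 hdvd)).trans (hn.1 0)

lemma partialSum_perp_eq (ν e : Fin 3 → ℕ) (N : ℕ) :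
    partialSum (perp ν) e N
      = ∑ d ∈ Finset.Icc 1 N, ((d : ℝ) ^ (∑ j, e j))⁻¹ * partialSum (primPerp ν) e (N / d) := by
  classical
  rw [partialSum, ← Finset.sum_fiberwise_of_maps_to (fun n hn => natAbs_gcd_mem hn)]
  refine Finset.sum_congr rfl fun d hd => ?_
  have hd := (Finset.mem_Icc.1 hd).1
  convert sum_boxed_filter_eq hd (natAbs_gcd_eq_iff hd) e N

/-- Möbius inversion: the sum of `μ(d)` over the divisors of the gcd of `n` detects the primitive
points. It transfers convergence from `perp ν` to its primitive points. -/
lemma partialSum_primPerp_eq (ν e : Fin 3 → ℕ) (N : ℕ) :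
    partialSum (primPerp ν) e N
      = ∑ d ∈ Finset.Icc 1 N, (ArithmeticFunction.moebius d * ((d : ℝ) ^ (∑ j, e j))⁻¹)
          * partialSum (perp ν) e (N / d) := by
  classical
  have h1 : ∀ d ∈ Finset.Icc 1 N, (ArithmeticFunction.moebius d * ((d : ℝ) ^ (∑ j, e j))⁻¹)
      * partialSum (perp ν) e (N / d) = ∑ n ∈ boxed (perp ν) N,
        if d ∣ (Finset.univ.gcd n).natAbs then (ArithmeticFunction.moebius d : ℝ) * invPow n e
          else 0 := by
    intro d hd
    have hd := (Finset.mem_Icc.1 hd).1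
    rw [mul_assoc, ← sum_boxed_filter_eq hd (dvd_gcd_iff hd) e N, Finset.mul_sum,
      Finset.sum_filter]
    exact Finset.sum_congr rfl fun n _ => by congr
  rw [Finset.sum_congr rfl h1, Finset.sum_comm]
  have h2 : ∀ n ∈ boxed (perp ν) N, ∑ d ∈ Finset.Icc 1 N,
      (if d ∣ (Finset.univ.gcd n).natAbs then (ArithmeticFunction.moebius d : ℝ) * invPow n e
        else 0) = if Finset.univ.gcd n = 1 then invPow n e else 0 := by
    intro n hn
    have hg := Finset.mem_Icc.1 (natAbs_gcd_mem hn)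
    rw [← Finset.sum_filter, ← Finset.sum_mul]
    have hdiv : (Finset.Icc 1 N).filter (fun d => d ∣ (Finset.univ.gcd n).natAbs)
        = (Finset.univ.gcd n).natAbs.divisors := by
      ext d
      simp only [Finset.mem_filter, Finset.mem_Icc, Nat.mem_divisors]
      constructor
      · exact fun h => ⟨h.2, by omega⟩
      · exact fun h => ⟨⟨Nat.pos_of_dvd_of_pos h.1 (by omega),
          (Nat.le_of_dvd (by omega) h.1).trans hg.2⟩, h.1⟩
    have hmu : ∑ d ∈ (Finset.univ.gcd n).natAbs.divisors, ArithmeticFunction.moebius d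
        = if (Finset.univ.gcd n).natAbs = 1 then 1 else 0 := by
      rw [← ArithmeticFunction.coe_mul_zeta_apply, ArithmeticFunction.moebius_mul_coe_zeta,
        ArithmeticFunction.one_apply]
    rw [hdiv, ← Int.cast_sum, hmu]
    have h3 : (Finset.univ.gcd n).natAbs = 1 ↔ Finset.univ.gcd n = 1 := by
      rw [← Finset.normalize_gcd, ← Int.abs_eq_normalize]
      have := abs_nonneg (Finset.univ.gcd n)
      omega
    by_cases h : Finset.univ.gcd n = 1
    · simp [h]
    · simp [h, h3]
  rw [Finset.sum_congr rfl h2, ← Finset.sum_filter, partialSum]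
  congr 1
  ext n
  simp only [Finset.mem_filter, mem_boxed, primPerp, Set.mem_ofPred_eq]
  tauto

lemma partialSum_perp_zero (ν e : Fin 3 → ℕ) : partialSum (perp ν) e 0 = 0 := by
  rw [partialSum_perp_eq]; simp

lemma partialSum_primPerp_zero (ν e : Fin 3 → ℕ) : partialSum (primPerp ν) e 0 = 0 := by
  rw [partialSum_primPerp_eq]; simp

/-- Convergence of the sums over `perp ν` implies convergence of the sums over its primitive
points, and the limits differ by the factor `ζ(w)`, where `w` is the degree. -/
theorem exists_tendsto_primPerp {ν e : Fin 3 → ℕ} {w : ℕ} (hw : ∑ j, e j = w) (hw2 : 2 ≤ w) {L : ℝ}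
    (hL : Tendsto (partialSum (perp ν) e) atTop (𝓝 L)) :
    ∃ P, Tendsto (partialSum (primPerp ν) e) atTop (𝓝 P) ∧ L = (∑' d : ℕ, ((d : ℝ) ^ w)⁻¹) * P := by
  subst hw
  set w := ∑ j, e j
  have hs : Summable (fun d : ℕ => ((d : ℝ) ^ w)⁻¹) := Real.summable_nat_pow_inv.2 hw2
  have hs' : Summable (fun d : ℕ => (ArithmeticFunction.moebius d : ℝ) * ((d : ℝ) ^ w)⁻¹) := by
    refine Summable.of_norm_bounded hs fun d => ?_
    rw [norm_mul, Real.norm_eq_abs, Real.norm_eq_abs, abs_of_nonneg (a := ((d : ℝ) ^ w)⁻¹)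
      (by positivity)]
    apply mul_le_of_le_one_left (by positivity)
    exact_mod_cast ArithmeticFunction.abs_moebius_le_one
  have hP := tendsto_sum_mul_div hs' hL (partialSum_perp_zero ν e) (by simp)
  rw [← funext (partialSum_primPerp_eq ν e)] at hP
  -- Once the primitive limit is known to exist, the forward convolution identifies `L` by
  -- uniqueness of limits.
  have hY := tendsto_sum_mul_div hs hP (partialSum_primPerp_zero ν e)
    (by simp [show w ≠ 0 by omega])
  rw [← funext (partialSum_perp_eq ν e)] at hY
  exact ⟨_, hP, tendsto_nhds_unique hL hY⟩

/-! ### Hirzebruch–Jung sequences -/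

section HirzebruchJung

variable {a b : ℕ}

/-- The recurrence preserves this determinant whatever the value of `κ`. -/
lemma hj_det (a b i : ℕ) :
    (hj a b i).1 * (hj a b (i + 1)).2 - (hj a b (i + 1)).1 * (hj a b i).2 = a := by
  induction i with
  | zero => simp [hj]
  | succ i ih => rw [hj]; linear_combination ih

/-- With `κ = ⌈x / y⌉`, the next term `κ y - x` is the remainder in division with excess, hence in
`[0, y)`. -/
lemma hj_succ_bounds {i : ℕ} (h : 0 < (hj a b (i + 1)).1) :
    0 ≤ (hj a b (i + 1 + 1)).1 ∧ (hj a b (i + 1 + 1)).1 < (hj a b (i + 1)).1 := by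
  rw [hj]
  generalize (hj a b i).1 = x
  generalize (hj a b (i + 1)).1 = y at *
  have hy : (0 : ℚ) < y := by exact_mod_cast h
  have h1 := Int.le_ceil ((x : ℚ) / y)
  have h2 := Int.ceil_lt_add_one ((x : ℚ) / y)
  rw [div_le_iff₀ hy] at h1
  have h3 : (⌈(x : ℚ) / y⌉ : ℚ) * y < x + y := by
    have := mul_lt_mul_of_pos_right h2 hy
    rwa [add_mul, div_mul_cancel₀ _ hy.ne', one_mul] at this
  have h1' : x ≤ ⌈(x : ℚ) / y⌉ * y := by exact_mod_cast h1
  have h3' : ⌈(x : ℚ) / y⌉ * y < x + y := by exact_mod_cast h3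
  simp only
  constructor <;> linarith

lemma exists_hj_eq_zero (a b : ℕ) : ∃ s, (hj a b (s + 1)).1 = 0 := by
  by_contra! h
  have key : ∀ i : ℕ, 0 < (hj a b (i + 1)).1 ∧ (hj a b (i + 1)).1 + i ≤ b := by
    intro i
    induction i with
    | zero =>
      have := h 0
      simp only [hj] at this ⊢
      omega
    | succ i ih =>
      have h1 := hj_succ_bounds ih.1
      have h2 := h (i + 1)
      push_cast
      omega
  have := key b
  omega

lemma hj_hjLength (a b : ℕ) : (hj a b (hjLength a b + 1)).1 = 0 :=
  Nat.sInf_mem (s := {s : ℕ | (hj a b (s + 1)).1 = 0}) (exists_hj_eq_zero a b)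

lemma hj_fst_pos (ha : 0 < a) {i : ℕ} (hi : i ≤ hjLength a b) : 0 < (hj a b i).1 := by
  have hne : ∀ i < hjLength a b, (hj a b (i + 1)).1 ≠ 0 := fun i hi =>
    Nat.notMem_of_lt_sInf (s := {s : ℕ | (hj a b (s + 1)).1 = 0}) hi
  induction i with
  | zero => simpa [hj] using ha
  | succ i ih =>
    have h0 := hne i (by omega)
    rcases i with _ | i
    · simp only [hj] at h0 ⊢
      omega
    · have := (hj_succ_bounds (ih (by omega))).1
      omega

lemma hj_fst_nonneg (ha : 0 < a) {i : ℕ} (hi : i ≤ hjLength a b + 1) : 0 ≤ (hj a b i).1 := by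
  rcases Nat.lt_or_ge (hjLength a b) i with h | h
  · obtain rfl : i = hjLength a b + 1 := by omega
    rw [hj_hjLength]
  · exact (hj_fst_pos ha h).le

/-- By the determinant identity, `m_i m̄_{i+1}` equals `a` plus the nonnegative `m_{i+1} m̄_i`. -/
lemma hj_snd_pos (ha : 0 < a) {i : ℕ} (hi : i ≤ hjLength a b) : 0 < (hj a b (i + 1)).2 := by
  induction i with
  | zero => simp [hj]
  | succ i ih =>
    have hdet := hj_det a b (i + 1)
    have h1 := hj_fst_pos ha hi
    have h2 := hj_fst_nonneg ha (Nat.succ_le_succ hi)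
    have h3 := ih (by omega)
    have ha' : (0 : ℤ) < a := by exact_mod_cast ha
    have : 0 < (hj a b (i + 1)).1 * (hj a b (i + 1 + 1)).2 := by nlinarith
    exact pos_of_mul_pos_right this h1.le

lemma hj_snd_nonneg (ha : 0 < a) {i : ℕ} (hi : i ≤ hjLength a b + 1) : 0 ≤ (hj a b i).2 := by
  rcases i with _ | i
  · simp [hj]
  · exact (hj_snd_pos ha (by omega)).le

/-- Once a point of the open cone lies on or below a ray, it lies strictly below the later rays. -/
lemma hj_side_neg (ha : 0 < a) {x y : ℤ} (hx : 0 < x) {i j : ℕ} (hij : i < j)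
    (hj' : j ≤ hjLength a b + 1) (h : (hj a b i).1 * y - (hj a b i).2 * x ≤ 0) :
    (hj a b j).1 * y - (hj a b j).2 * x < 0 := by
  have step : ∀ i, i ≤ hjLength a b → (hj a b i).1 * y - (hj a b i).2 * x ≤ 0 →
      (hj a b (i + 1)).1 * y - (hj a b (i + 1)).2 * x < 0 := by
    intro i hi h
    have hdet := hj_det a b i
    have h1 := hj_fst_pos ha hi
    have h2 := hj_fst_nonneg (b := b) ha (Nat.succ_le_succ hi)
    have ha' : (0 : ℤ) < a := by exact_mod_cast ha
    have : (hj a b i).1 * ((hj a b (i + 1)).1 * y - (hj a b (i + 1)).2 * x)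
        = (hj a b (i + 1)).1 * ((hj a b i).1 * y - (hj a b i).2 * x) - a * x := by
      rw [← hdet]; ring
    have hax : 0 < (a : ℤ) * x := mul_pos ha' hx
    have hle : (hj a b (i + 1)).1 * ((hj a b i).1 * y - (hj a b i).2 * x) ≤ 0 :=
      mul_nonpos_of_nonneg_of_nonpos h2 h
    by_contra hcon
    push Not at hcon
    have := mul_nonneg h1.le hcon
    linarith
  induction j, hij using Nat.le_induction with
  | base => exact step i (by omega) h
  | succ j hj ih => exact step j (by omega) (ih (by omega)).le

end HirzebruchJung

/-! ### Subdivision of a cone into rays and open subcones -/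

section Cone

variable {ν : Fin 3 → ℕ}

lemma edge_succ (ν : Fin 3 → ℕ) (l : Fin 3) : edge ν (l + 1) l = ν (l + 2) ∧
    edge ν (l + 1) (l + 1) = 0 ∧ edge ν (l + 1) (l + 2) = ν l ∧
    edge ν (l + 2) l = ν (l + 1) ∧ edge ν (l + 2) (l + 1) = ν l ∧ edge ν (l + 2) (l + 2) = 0 := by
  fin_cases l <;> simp [edge]

lemma fin_three_cases (l j : Fin 3) : j = l ∨ j = l + 1 ∨ j = l + 2 := by
  revert l j; decide

lemma ne_succ (l : Fin 3) : l ≠ l + 1 ∧ l ≠ l + 2 ∧ l + 1 ≠ l + 2 := by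
  revert l; decide

lemma sum_fin_three (l : Fin 3) {M : Type*} [AddCommMonoid M] (f : Fin 3 → M) :
    ∑ t, f t = f l + f (l + 1) + f (l + 2) :=
  sum_fin_three_of_ne (ne_succ l).1 (ne_succ l).2.1 (ne_succ l).2.2 f

lemma signVec_succ (l : Fin 3) : signVec l (l + 1) = -signVec l l ∧
    signVec l (l + 2) = -signVec l l ∧ signVec l l ^ 2 = 1 := by
  revert l; decide

/-- The coefficients of the plane which contains the cone spanned by `v_{l'}` and `v_{l''}`. -/
def coneCoeff (ν : Fin 3 → ℕ) (l : Fin 3) : Fin 3 → ℤ := fun t => signVec l t * ν t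

lemma mem_lat_coneCoeff {l : Fin 3} {n : Fin 3 → ℤ} : n ∈ lat (coneCoeff ν l) ↔
    (ν l : ℤ) * n l = ν (l + 1) * n (l + 1) + ν (l + 2) * n (l + 2) := by
  obtain ⟨h1, h2, h3⟩ := signVec_succ l
  simp only [lat, Set.mem_ofPred_eq, sum_fin_three l, coneCoeff, h1, h2]
  have hs : signVec l l ≠ 0 := by rintro h; simp [h] at h3
  rw [← mul_right_inj' (b := (ν l : ℤ) * n l) hs]
  constructor <;> intro h <;> linarith

lemma epsilon_spec (hν_coprime : Pairwise fun i j => Nat.Coprime (ν i) (ν j))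
    (hν_pos : ∀ j, 0 < ν j) (l : Fin 3) :
    (ν l : ℤ) ∣ (epsilon ν l : ℤ) * ν (l + 2) + ν (l + 1) := by
  have hne : {e : ℕ | ∀ j, (ν l : ℤ) ∣ (e : ℤ) * edge ν (l + 1) j + edge ν (l + 2) j}.Nonempty := by
    obtain ⟨u, v, huv⟩ : IsCoprime (ν (l + 2) : ℤ) (ν l : ℤ) :=
      Nat.isCoprime_iff_coprime.2 (hν_coprime (ne_succ l).2.1.symm)
    have hl : (ν l : ℤ) ≠ 0 := by exact_mod_cast (hν_pos l).ne'
    -- Only coordinate `l` imposes a condition, solved with the inverse `u` of `ν (l + 2)` modulo `ν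
    -- l`.
    refine ⟨((-u * ν (l + 1)) % ν l).toNat, fun j => ?_⟩
    rw [Int.toNat_of_nonneg (Int.emod_nonneg _ hl)]
    obtain ⟨e1, e2, e3, e4, e5, e6⟩ := edge_succ ν l
    rcases fin_three_cases l j with rfl | rfl | rfl
    · rw [e1, e4, Int.emod_def]
      refine ⟨-((-u * ν (j + 1)) / ν j) * ν (j + 2) + v * ν (j + 1), ?_⟩
      linear_combination (-(ν (j + 1) : ℤ)) * huv
    · rw [e2, e5]; simp
    · rw [e3, e6]; simp
  have h := Nat.sInf_mem hne l
  rwa [(edge_succ ν l).1, (edge_succ ν l).2.2.2.1] at h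

lemma dvd_hj (hν_coprime : Pairwise fun i j => Nat.Coprime (ν i) (ν j))
    (hν_pos : ∀ j, 0 < ν j) (l : Fin 3) (i : ℕ) :
    (ν l : ℤ) ∣ (hj (ν l) (epsilon ν l) i).1 * ν (l + 2)
      + (hj (ν l) (epsilon ν l) i).2 * ν (l + 1) := by
  suffices h : ((ν l : ℤ) ∣ (hj (ν l) (epsilon ν l) i).1 * ν (l + 2)
      + (hj (ν l) (epsilon ν l) i).2 * ν (l + 1)) ∧
      ((ν l : ℤ) ∣ (hj (ν l) (epsilon ν l) (i + 1)).1 * ν (l + 2)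
      + (hj (ν l) (epsilon ν l) (i + 1)).2 * ν (l + 1)) from h.1
  induction i with
  | zero => exact ⟨by simp [hj], by simpa [hj] using epsilon_spec hν_coprime hν_pos l⟩
  | succ i ih =>
    refine ⟨ih.2, ?_⟩
    rw [hj]
    obtain ⟨⟨x, hx⟩, y, hy⟩ := ih
    set κ := ⌈((hj (ν l) (epsilon ν l) i).1 : ℚ) / ((hj (ν l) (epsilon ν l) (i + 1)).1 : ℚ)⌉
    refine ⟨κ * y - x, ?_⟩
    linear_combination κ * hy - hx

/-- Ray coordinates: the last two coordinates are the Hirzebruch–Jung pair, and the ray lies in the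
plane of the cone. -/
lemma ray_spec (hν_coprime : Pairwise fun i j => Nat.Coprime (ν i) (ν j))
    (hν_pos : ∀ j, 0 < ν j) (l : Fin 3) (i : ℕ) :
    ray ν l i (l + 2) = (hj (ν l) (epsilon ν l) i).1 ∧
    ray ν l i (l + 1) = (hj (ν l) (epsilon ν l) i).2 ∧ ray ν l i ∈ lat (coneCoeff ν l) := by
  have hl : (ν l : ℤ) ≠ 0 := by exact_mod_cast (hν_pos l).ne'
  obtain ⟨e1, e2, e3, e4, e5, e6⟩ := edge_succ ν l
  have h2 : ray ν l i (l + 2) = (hj (ν l) (epsilon ν l) i).1 := by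
    rw [ray, e3, e6, mul_zero, add_zero, Int.mul_ediv_cancel _ hl]
  have h1 : ray ν l i (l + 1) = (hj (ν l) (epsilon ν l) i).2 := by
    rw [ray, e2, e5, mul_zero, zero_add, Int.mul_ediv_cancel _ hl]
  refine ⟨h2, h1, ?_⟩
  rw [mem_lat_coneCoeff, h1, h2, ray, e1, e4,
    Int.mul_ediv_cancel' (dvd_hj hν_coprime hν_pos l i)]
  ring

/-- The side of the ray `v_{l,i}` on which a point lies. -/
noncomputable def raySide (ν : Fin 3 → ℕ) (l : Fin 3) (i : ℕ) (n : Fin 3 → ℤ) : ℤ :=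
  (hj (ν l) (epsilon ν l) i).1 * n (l + 1) - (hj (ν l) (epsilon ν l) i).2 * n (l + 2)

/-- Cramer's rule in the coordinates `l + 1`, `l + 2`, where the two rays have determinant `ν l`: if
`n = α v + β w`, the two sides are `β ν_l` and `-α ν_l`. Coordinate `l` follows from the plane
equation. -/
lemma mem_subCone_iff (hν_coprime : Pairwise fun i j => Nat.Coprime (ν i) (ν j))
    (hν_pos : ∀ j, 0 < ν j) (l : Fin 3) (i : ℕ) (n : Fin 3 → ℤ) :
    (fun j => (n j : ℝ)) ∈ subCone ν l i ↔
      n ∈ lat (coneCoeff ν l) ∧ 0 < raySide ν l i n ∧ raySide ν l (i + 1) n < 0 := by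
  obtain ⟨h2, h1, hr⟩ := ray_spec hν_coprime hν_pos l i
  obtain ⟨h2', h1', hr'⟩ := ray_spec hν_coprime hν_pos l (i + 1)
  have hdet := hj_det (ν l) (epsilon ν l) i
  have hl : (0 : ℝ) < ν l := by exact_mod_cast hν_pos l
  rw [mem_lat_coneCoeff] at hr hr' ⊢
  simp only [raySide, ← h1, ← h2, ← h1', ← h2'] at hdet ⊢
  simp only [subCone, openCone, Set.mem_ofPred_eq]
  generalize ray ν l i = v at *
  generalize ray ν l (i + 1) = w at *
  have hdet' : (v (l + 2) : ℝ) * w (l + 1) - w (l + 2) * v (l + 1) = ν l := by exact_mod_cast hdet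
  have hr : (ν l : ℝ) * v l = ν (l + 1) * v (l + 1) + ν (l + 2) * v (l + 2) := by exact_mod_cast hr
  have hr' : (ν l : ℝ) * w l = ν (l + 1) * w (l + 1) + ν (l + 2) * w (l + 2) := by
    exact_mod_cast hr'
  constructor
  · rintro ⟨α, β, hα, hβ, h⟩
    refine ⟨?_, ?_, ?_⟩
    · have : (ν l : ℝ) * n l = ν (l + 1) * n (l + 1) + ν (l + 2) * n (l + 2) := by
        rw [h l, h (l + 1), h (l + 2)]
        linear_combination α * hr + β * hr'
      exact_mod_cast this
    · have : (0 : ℝ) < v (l + 2) * n (l + 1) - v (l + 1) * n (l + 2) := by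
        have e : (v (l + 2) : ℝ) * n (l + 1) - v (l + 1) * n (l + 2) = β * ν l := by
          rw [h (l + 1), h (l + 2)]; linear_combination β * hdet'
        rw [e]; positivity
      exact_mod_cast this
    · have : (w (l + 2) : ℝ) * n (l + 1) - w (l + 1) * n (l + 2) < 0 := by
        have e : (w (l + 2) : ℝ) * n (l + 1) - w (l + 1) * n (l + 2) = -(α * ν l) := by
          rw [h (l + 1), h (l + 2)]; linear_combination -α * hdet'
        rw [e, neg_lt_zero]; positivity
      exact_mod_cast this
  · rintro ⟨hn, hv, hw⟩
    have hn : (ν l : ℝ) * n l = ν (l + 1) * n (l + 1) + ν (l + 2) * n (l + 2) := by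
      exact_mod_cast hn
    have hv : (0 : ℝ) < v (l + 2) * n (l + 1) - v (l + 1) * n (l + 2) := by exact_mod_cast hv
    have hw : (w (l + 2) : ℝ) * n (l + 1) - w (l + 1) * n (l + 2) < 0 := by exact_mod_cast hw
    refine ⟨-(w (l + 2) * n (l + 1) - w (l + 1) * n (l + 2)) / ν l,
      (v (l + 2) * n (l + 1) - v (l + 1) * n (l + 2)) / ν l,
      div_pos (by linarith) hl, div_pos hv hl, fun j => ?_⟩
    rw [div_mul_eq_mul_div, div_mul_eq_mul_div, ← add_div, eq_div_iff hl.ne']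
    rcases fin_three_cases l j with rfl | rfl | rfl
    · apply mul_left_cancel₀ hl.ne'
      linear_combination (ν j : ℝ) * hn - (ν (j + 1) * n (j + 1) + ν (j + 2) * n (j + 2)) * hdet'
        + (w (j + 2) * n (j + 1) - w (j + 1) * n (j + 2)) * hr
        - (v (j + 2) * n (j + 1) - v (j + 1) * n (j + 2)) * hr'
    · linear_combination (-(n (l + 1) : ℝ)) * hdet'
    · linear_combination (-(n (l + 2) : ℝ)) * hdet'

/-- The primitive integer points in the open cone spanned by `v_{l'}` and `v_{l''}`. -/
def primCone (ν : Fin 3 → ℕ) (l : Fin 3) : Set (Fin 3 → ℤ) :=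
  {n | (n ∈ lat (coneCoeff ν l) ∧ ∀ j, 0 < n j) ∧ Finset.univ.gcd n = 1}

lemma pos_of_mem_lat_coneCoeff (hν_pos : ∀ j, 0 < ν j) {l : Fin 3} {n : Fin 3 → ℤ}
    (hn : n ∈ lat (coneCoeff ν l)) (h1 : 0 < n (l + 1)) (h2 : 0 < n (l + 2)) (j : Fin 3) :
    0 < n j := by
  rw [mem_lat_coneCoeff] at hn
  rcases fin_three_cases l j with rfl | rfl | rfl
  · have hpos : ∀ j, 0 < (ν j : ℤ) := fun j => by exact_mod_cast hν_pos j
    have : 0 < (ν j : ℤ) * n j := by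
      rw [hn]
      have := mul_pos (hpos (j + 1)) h1
      have := mul_pos (hpos (j + 2)) h2
      linarith
    exact pos_of_mul_pos_right this (hpos j).le
  · exact h1
  · exact h2

lemma ray_mem_primCone (hν_coprime : Pairwise fun i j => Nat.Coprime (ν i) (ν j))
    (hν_pos : ∀ j, 0 < ν j) {l : Fin 3} {i : ℕ} (hi : i ∈ Finset.Icc 1 (rayCount ν l)) :
    ray ν l i ∈ primCone ν l := by
  obtain ⟨hi1, his⟩ := Finset.mem_Icc.1 hi
  obtain ⟨h2, h1, hr⟩ := ray_spec hν_coprime hν_pos l i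
  obtain ⟨h2', h1', hr'⟩ := ray_spec hν_coprime hν_pos l (i + 1)
  refine ⟨⟨hr, pos_of_mem_lat_coneCoeff hν_pos hr ?_ ?_⟩, ?_⟩
  · rw [h1]
    obtain ⟨i, rfl⟩ := Nat.exists_eq_succ_of_ne_zero (by omega : i ≠ 0)
    exact hj_snd_pos (hν_pos l) (by rw [rayCount] at his; omega)
  · rw [h2]; exact hj_fst_pos (hν_pos l) his
  -- Primitivity: a common divisor of the ray divides its minors with the next ray. Two of them are
  -- `ν l` and `ν (l + 1)`, which are coprime.
  · rw [gcd_eq_one_iff]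
    intro d hd
    have hdet := hj_det (ν l) (epsilon ν l) i
    rw [mem_lat_coneCoeff] at hr hr'
    rw [← h1, ← h2, ← h1', ← h2'] at hdet
    have hl : (ν l : ℤ) ≠ 0 := by exact_mod_cast (hν_pos l).ne'
    have d1 : d ∣ ν l := by
      rw [← hdet]
      exact ((hd _).mul_right _).sub ((hd _).mul_left _)
    have d2 : d ∣ ν (l + 1) := by
      have e : ray ν l i (l + 2) * ray ν l (i + 1) l - ray ν l (i + 1) (l + 2) * ray ν l i l
          = ν (l + 1) := by
        apply mul_left_cancel₀ hl
        linear_combination ray ν l i (l + 2) * hr' - ray ν l (i + 1) (l + 2) * hr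
          + (ν (l + 1) : ℤ) * hdet
      rw [← e]
      exact ((hd _).mul_right _).sub ((hd _).mul_left _)
    exact (Nat.isCoprime_iff_coprime.2 (hν_coprime (ne_succ l).1)).isUnit_of_dvd' d1 d2 |>.dvd

lemma raySide_ray (hν_coprime : Pairwise fun i j => Nat.Coprime (ν i) (ν j))
    (hν_pos : ∀ j, 0 < ν j) (l : Fin 3) (i : ℕ) : raySide ν l i (ray ν l i) = 0 := by
  obtain ⟨h2, h1, -⟩ := ray_spec hν_coprime hν_pos l i
  rw [raySide, h1, h2]; ring

lemma eq_ray_of_raySide_eq_zero (hν_coprime : Pairwise fun i j => Nat.Coprime (ν i) (ν j))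
    (hν_pos : ∀ j, 0 < ν j) {l : Fin 3} {i : ℕ} (hi : i ∈ Finset.Icc 1 (rayCount ν l))
    {n : Fin 3 → ℤ} (hn : n ∈ primCone ν l) (h : raySide ν l i n = 0) : n = ray ν l i := by
  have hv := ray_mem_primCone hν_coprime hν_pos hi
  obtain ⟨h2, h1, -⟩ := ray_spec hν_coprime hν_pos l i
  rw [raySide, ← h1, ← h2] at h
  generalize ray ν l i = v at *
  obtain ⟨⟨hn, hnpos⟩, hn1⟩ := hn
  obtain ⟨⟨hv, hvpos⟩, hv1⟩ := hv
  rw [mem_lat_coneCoeff] at hn hv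
  have hl : (ν l : ℤ) ≠ 0 := by exact_mod_cast (hν_pos l).ne'
  -- The two vectors are proportional; comparing gcds of both sides makes the positive factors
  -- equal.
  have key : (fun j => v (l + 2) * n j) = fun j => n (l + 2) * v j := by
    funext j
    rcases fin_three_cases l j with rfl | rfl | rfl
    · apply mul_left_cancel₀ hl
      linear_combination v (j + 2) * hn - n (j + 2) * hv + (ν (j + 1) : ℤ) * h
    · linear_combination h
    · ring
  have hg := congrArg (Finset.gcd Finset.univ) key
  rw [Finset.gcd_mul_left, Finset.gcd_mul_left, hn1, hv1, mul_one, mul_one,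
    Int.normalize_of_nonneg (hvpos _).le, Int.normalize_of_nonneg (hnpos _).le] at hg
  funext j
  have := congrFun key j
  simp only [hg] at this
  exact mul_left_cancel₀ (hnpos _).ne' this

lemma primitivePoints_subCone_subset (hν_coprime : Pairwise fun i j => Nat.Coprime (ν i) (ν j))
    (hν_pos : ∀ j, 0 < ν j) {l : Fin 3} {i : ℕ} (hi : i ≤ rayCount ν l) :
    primitivePoints (subCone ν l i) ⊆ primCone ν l := by
  rintro n ⟨hn, hg⟩
  obtain ⟨hlat, hs, hs'⟩ := (mem_subCone_iff hν_coprime hν_pos l i n).1 hn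
  refine ⟨⟨hlat, pos_of_mem_lat_coneCoeff hν_pos hlat ?_ ?_⟩, hg⟩
  -- Cramer's rule writes `ν_l n_{l+1}` and `ν_l n_{l+2}` as nonnegative combinations of the two
  -- sides, with one strictly positive term.
  all_goals
    have hdet := hj_det (ν l) (epsilon ν l) i
    have p1 := hj_fst_pos (b := epsilon ν l) (hν_pos l) hi
    have p2 := hj_fst_nonneg (b := epsilon ν l) (hν_pos l) (Nat.succ_le_succ hi)
    have p3 := hj_snd_nonneg (b := epsilon ν l) (hν_pos l) (hi.trans (Nat.le_succ _))
    have p4 := hj_snd_pos (b := epsilon ν l) (hν_pos l) hi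
    rw [raySide] at hs hs'
    have hl : (0 : ℤ) < ν l := by exact_mod_cast hν_pos l
    refine pos_of_mul_pos_right (a := (ν l : ℤ)) ?_ hl.le
    rw [← hdet]
    simp only [Nat.succ_eq_add_one] at p2
    generalize (hj (ν l) (epsilon ν l) i).1 = m at *
    generalize (hj (ν l) (epsilon ν l) i).2 = m' at *
    generalize (hj (ν l) (epsilon ν l) (i + 1)).1 = k at *
    generalize (hj (ν l) (epsilon ν l) (i + 1)).2 = k' at *
  · have e : (m * k' - k * m') * n (l + 1)
        = k' * (m * n (l + 1) - m' * n (l + 2)) + m' * (-(k * n (l + 1) - k' * n (l + 2))) := by ring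
    rw [e]
    have := mul_pos p4 hs
    have := mul_nonneg p3 (neg_nonneg.2 hs'.le)
    linarith
  · have e : (m * k' - k * m') * n (l + 2)
        = k * (m * n (l + 1) - m' * n (l + 2)) + m * (-(k * n (l + 1) - k' * n (l + 2))) := by ring
    rw [e]
    have := mul_nonneg p2 hs.le
    have := mul_pos p1 (neg_pos.2 hs')
    linarith

lemma raySide_neg_of_lt (hν_pos : ∀ j, 0 < ν j) {l : Fin 3} {i j : ℕ} (hij : i < j)
    (hj' : j ≤ rayCount ν l + 1) {n : Fin 3 → ℤ} (hn : n ∈ primCone ν l)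
    (h : raySide ν l i n ≤ 0) : raySide ν l j n < 0 :=
  hj_side_neg (hν_pos l) (hn.1.2 _) hij hj' h

/-- The side is positive for the first ray and negative for the last. At the first index where it is
not positive, zero places the point on that ray and a negative value in the preceding subcone. -/
lemma primCone_cover (hν_coprime : Pairwise fun i j => Nat.Coprime (ν i) (ν j))
    (hν_pos : ∀ j, 0 < ν j) {l : Fin 3} {n : Fin 3 → ℤ} (hn : n ∈ primCone ν l) :
    (∃ i ∈ Finset.Icc 1 (rayCount ν l), n = ray ν l i) ∨
      ∃ i ∈ Finset.range (rayCount ν l + 1), n ∈ primitivePoints (subCone ν l i) := by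
  classical
  have hl : (0 : ℤ) < ν l := by exact_mod_cast hν_pos l
  have hlast : raySide ν l (rayCount ν l + 1) n < 0 := by
    have h0 : (hj (ν l) (epsilon ν l) (rayCount ν l + 1)).1 = 0 := hj_hjLength _ _
    have h1 : 0 < (hj (ν l) (epsilon ν l) (rayCount ν l + 1)).2 := hj_snd_pos (hν_pos l) le_rfl
    rw [raySide, h0, zero_mul, zero_sub, neg_lt_zero]
    exact mul_pos h1 (hn.1.2 _)
  have hfirst : 0 < raySide ν l 0 n := by
    simp only [raySide, hj, zero_mul, sub_zero]
    exact mul_pos hl (hn.1.2 _)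
  have hex : ∃ i, raySide ν l i n ≤ 0 := ⟨_, hlast.le⟩
  have hspec := Nat.find_spec hex
  have hle : Nat.find hex ≤ rayCount ν l + 1 := Nat.find_min' hex hlast.le
  have hmin := fun m => Nat.find_min (m := m) hex
  generalize Nat.find hex = i at *
  rcases i with _ | i
  · linarith
  have hi := hmin i (Nat.lt_succ_self i)
  push Not at hi
  rcases hspec.lt_or_eq with h | h
  · right
    exact ⟨i, Finset.mem_range.2 (by omega),
      (mem_subCone_iff hν_coprime hν_pos l i n).2 ⟨hn.1.1, hi, h⟩, hn.2⟩
  · left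
    -- The index `i + 1` is not the outer ray, on whose side the point lies strictly.
    have hne : i ≠ rayCount ν l := by rintro rfl; linarith
    have hmem : i + 1 ∈ Finset.Icc 1 (rayCount ν l) := Finset.mem_Icc.2 ⟨by omega, by omega⟩
    exact ⟨i + 1, hmem, eq_ray_of_raySide_eq_zero hν_coprime hν_pos hmem hn h⟩

/-- The decomposition of the primitive points of the cone into rays and open subcones. -/
lemma partialSum_primCone (hν_coprime : Pairwise fun i j => Nat.Coprime (ν i) (ν j))
    (hν_pos : ∀ j, 0 < ν j) (l : Fin 3) (e : Fin 3 → ℕ) {N : ℕ}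
    (hN : ∀ i ∈ Finset.Icc 1 (rayCount ν l), ∀ j, (ray ν l i j).natAbs ≤ N) :
    partialSum (primCone ν l) e N = ∑ i ∈ Finset.Icc 1 (rayCount ν l), invPow (ray ν l i) e
      + ∑ i ∈ Finset.range (rayCount ν l + 1),
          partialSum (primitivePoints (subCone ν l i)) e N := by
  classical
  have hset : boxed (primCone ν l) N = (Finset.Icc 1 (rayCount ν l)).image (ray ν l) ∪
      (Finset.range (rayCount ν l + 1)).biUnion
        fun i => boxed (primitivePoints (subCone ν l i)) N := by
    ext n
    simp only [mem_boxed_natAbs, Finset.mem_union, Finset.mem_image, Finset.mem_biUnion]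
    constructor
    · rintro ⟨hb, hn⟩
      rcases primCone_cover hν_coprime hν_pos hn with ⟨i, hi, rfl⟩ | ⟨i, hi, h⟩
      · exact .inl ⟨i, hi, rfl⟩
      · exact .inr ⟨i, hi, hb, h⟩
    · rintro (⟨i, hi, rfl⟩ | ⟨i, hi, hb, h⟩)
      · exact ⟨hN i hi, ray_mem_primCone hν_coprime hν_pos hi⟩
      · exact ⟨hb, primitivePoints_subCone_subset hν_coprime hν_pos
          (Nat.lt_succ_iff.1 (Finset.mem_range.1 hi)) h⟩
  rw [partialSum, hset, Finset.sum_union, Finset.sum_image, Finset.sum_biUnion]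
  · rfl
  · intro i hi i' hi' hne
    wlog hlt : i < i' generalizing i i'
    · exact (this hi' hi hne.symm (by omega)).symm
    simp only [Function.onFun, Finset.disjoint_left, mem_boxed_natAbs]
    rintro n ⟨-, hn⟩ ⟨-, hn'⟩
    rw [Finset.mem_coe, Finset.mem_range] at hi hi'
    have hp := primitivePoints_subCone_subset hν_coprime hν_pos (Nat.lt_succ_iff.1 hi) hn
    have h1 := ((mem_subCone_iff hν_coprime hν_pos l i n).1 hn.1).2.2
    have h2 := ((mem_subCone_iff hν_coprime hν_pos l i' n).1 hn'.1).2.1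
    rcases Nat.lt_or_ge (i + 1) i' with h | h
    · linarith [raySide_neg_of_lt hν_pos h (by omega) hp h1.le]
    · obtain rfl : i' = i + 1 := by omega
      linarith
  · intro i hi i' hi' heq
    by_contra hne
    wlog hlt : i < i' generalizing i i'
    · exact this hi' hi heq.symm (Ne.symm hne) (by omega)
    have hp := ray_mem_primCone hν_coprime hν_pos (Finset.mem_coe.1 hi')
    have h0 := raySide_ray hν_coprime hν_pos l i
    rw [heq] at h0
    have := raySide_neg_of_lt hν_pos hlt
      ((Finset.mem_Icc.1 (Finset.mem_coe.1 hi')).2.trans (Nat.le_succ _)) hp h0.le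
    rw [raySide_ray hν_coprime hν_pos l i'] at this
    exact lt_irrefl _ this
  · rw [Finset.disjoint_left]
    intro n hn hn'
    obtain ⟨i, hi, rfl⟩ := Finset.mem_image.1 hn
    obtain ⟨i', hi', h⟩ := Finset.mem_biUnion.1 hn'
    have h := (mem_boxed.1 h).2
    have hp := ray_mem_primCone hν_coprime hν_pos hi
    obtain ⟨-, h1, h2⟩ := (mem_subCone_iff hν_coprime hν_pos l i' _).1 h.1
    have h0 := raySide_ray hν_coprime hν_pos l i
    rw [Finset.mem_range] at hi'
    rw [Finset.mem_Icc] at hi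
    rcases lt_trichotomy i i' with hlt | rfl | hlt
    · linarith [raySide_neg_of_lt hν_pos hlt (by omega) hp h0.le]
    · linarith
    · rcases Nat.lt_or_ge (i' + 1) i with hlt' | hge
      · linarith [raySide_neg_of_lt hν_pos hlt' (by omega) hp h2.le]
      · obtain rfl : i = i' + 1 := by omega
        linarith

end Cone

/-! ### The six sign cones -/

lemma signVec_sq (l j : Fin 3) : signVec l j * signVec l j = 1 := by
  revert l j; decide

/-- Positive weights exclude three coordinates of equal sign; the other six sign patterns are
exactly `±u_l`. -/
lemma exists_signVec_mul_pos {n : Fin 3 → ℤ} {ν : Fin 3 → ℕ} (hν_pos : ∀ j, 0 < ν j)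
    (hn : n ∈ perp ν) : ∃ l : Fin 3, ∃ s ∈ ({1, -1} : Finset ℤ), ∀ j, 0 < s * signVec l j * n j := by
  obtain ⟨h, h0⟩ := hn
  rw [Fin.sum_univ_three] at h
  have hν : ∀ j, 0 < (ν j : ℤ) := fun j => by exact_mod_cast hν_pos j
  have pos : ∀ j, 0 < n j → 0 < (ν j : ℤ) * n j := fun j hj => mul_pos (hν j) hj
  have neg : ∀ j, n j < 0 → (ν j : ℤ) * n j < 0 := fun j hj => mul_neg_of_pos_of_neg (hν j) hj
  rcases lt_or_gt_of_ne (h0 0) with a | a <;> rcases lt_or_gt_of_ne (h0 1) with b | b <;>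
    rcases lt_or_gt_of_ne (h0 2) with c | c
  · linarith [neg 0 a, neg 1 b, neg 2 c]
  · exact ⟨2, -1, by simp, by simp [Fin.forall_fin_succ, signVec]; omega⟩
  · exact ⟨1, -1, by simp, by simp [Fin.forall_fin_succ, signVec]; omega⟩
  · exact ⟨0, -1, by simp, by simp [Fin.forall_fin_succ, signVec]; omega⟩
  · exact ⟨0, 1, by simp, by simp [Fin.forall_fin_succ, signVec]; omega⟩
  · exact ⟨1, 1, by simp, by simp [Fin.forall_fin_succ, signVec]; omega⟩
  · exact ⟨2, 1, by simp, by simp [Fin.forall_fin_succ, signVec]; omega⟩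
  · linarith [pos 0 a, pos 1 b, pos 2 c]

lemma signVec_injective : ∀ l l' : Fin 3, ∀ s ∈ ({1, -1} : Finset ℤ), ∀ s' ∈ ({1, -1} : Finset ℤ),
    (∀ j, s * signVec l j = s' * signVec l' j) → l = l' ∧ s = s' := by
  decide

/-- The global sign `s` enters with the even exponent `|q̄|` and disappears; the signs `u_l` give
`σ_{k,l}`, being their own inverses. -/
lemma invPow_sign {s : ℤ} (hs : s ∈ ({1, -1} : Finset ℤ)) (k l : Fin 3) (q : Fin 3 → ℕ)
    (heven : Even (∑ j, dropAt q k j)) (n : Fin 3 → ℤ) :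
    invPow (fun j => s * signVec l j * n j) (dropAt q k) = sign q k l * invPow n (dropAt q k) := by
  have h1 : (fun j => s * signVec l j * n j) = fun j => s * (signVec l j * n j) := by
    funext j; ring
  have h2 : ((s : ℝ) ^ ∑ j, dropAt q k j) = 1 := by
    simp only [Finset.mem_insert, Finset.mem_singleton] at hs
    rcases hs with rfl | rfl
    · simp
    · simpa using heven.neg_one_pow
  rw [h1, invPow_mul, h2, inv_one, one_mul]
  simp only [invPow, Int.cast_mul, mul_pow, mul_inv, Finset.prod_mul_distrib, sign, Int.cast_prod,
    Int.cast_pow]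
  congr 1
  refine Finset.prod_congr rfl fun j _ => ?_
  rw [← inv_pow]
  congr 1
  have := signVec_sq l j
  exact inv_eq_of_mul_eq_one_left (by exact_mod_cast this)

lemma gcd_sign {u n : Fin 3 → ℤ} (hu : ∀ j, u j * u j = 1) (hn : Finset.univ.gcd n = 1) :
    Finset.univ.gcd (fun j => u j * n j) = 1 := by
  rw [gcd_eq_one_iff] at hn ⊢
  intro d hd
  refine hn d fun j => ?_
  have := (hd j).mul_left (u j)
  rwa [← mul_assoc, hu, one_mul] at this

/-- Decomposition of the primitive points of `perp ν` into six cones. -/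
lemma partialSum_primPerp {ν : Fin 3 → ℕ} (hν_pos : ∀ j, 0 < ν j) (q : Fin 3 → ℕ) (k : Fin 3)
    (heven : Even (∑ j, dropAt q k j)) (N : ℕ) :
    partialSum (primPerp ν) (dropAt q k) N
      = 2 * ∑ l, sign q k l * partialSum (primCone ν l) (dropAt q k) N := by
  have hsq : ∀ s ∈ ({1, -1} : Finset ℤ), s * s = 1 := by decide
  have hu : ∀ l : Fin 3, ∀ s ∈ ({1, -1} : Finset ℤ), ∀ j,
      (s * signVec l j) * (s * signVec l j) = 1 := fun l s hs j => by
    linear_combination (signVec l j * signVec l j) * hsq s hs + signVec_sq l j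
  -- The factor `2` becomes a sum over `s = ±1`, so that `(l, s, n) ↦ s u_l n` is a bijection onto
  -- the primitive points of `perp ν` in the cube.
  have hfin : ∀ l : Fin 3, sign q k l * partialSum (primCone ν l) (dropAt q k) N * 2
      = ∑ p ∈ ({1, -1} : Finset ℤ) ×ˢ boxed (primCone ν l) N,
        invPow (fun j => p.1 * signVec l j * p.2 j) (dropAt q k) := by
    intro l
    rw [Finset.sum_product]
    have : ∀ s ∈ ({1, -1} : Finset ℤ), ∑ n ∈ boxed (primCone ν l) N,
        invPow (fun j => s * signVec l j * n j) (dropAt q k)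
        = sign q k l * partialSum (primCone ν l) (dropAt q k) N := by
      intro s hs
      rw [partialSum, Finset.mul_sum]
      exact Finset.sum_congr rfl fun n _ => invPow_sign hs k l q heven n
    rw [Finset.sum_congr rfl this]
    simp
    ring
  rw [mul_comm, Finset.sum_mul, Finset.sum_congr rfl fun l _ => hfin l, Finset.sum_sigma', partialSum]
  symm
  refine Finset.sum_nbij (fun x => fun j => x.2.1 * signVec x.1 j * x.2.2 j) ?_ ?_ ?_ ?_
  · rintro ⟨l, s, n⟩ hx
    simp only [Finset.mem_sigma, Finset.mem_univ, true_and, Finset.mem_product,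
      mem_boxed_natAbs] at hx
    obtain ⟨hs, hb, ⟨⟨hlat, hpos⟩, hg⟩⟩ := hx
    have hne : ∀ j, s * signVec l j ≠ 0 := fun j h => by
      have := hu l s hs j
      rw [h] at this
      norm_num at this
    rw [mem_boxed_natAbs]
    refine ⟨fun j => ?_, ⟨?_, fun j => ?_⟩, gcd_sign (hu l s hs) hg⟩
    · have : (s * signVec l j).natAbs = 1 := by
        rcases mul_self_eq_one_iff.1 (hu l s hs j) with h | h <;> simp [h]
      rw [Int.natAbs_mul, this, one_mul]
      exact hb j
    · have : ∑ j, (ν j : ℤ) * (s * signVec l j * n j) = s * ∑ j, coneCoeff ν l j * n j := by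
        rw [Finset.mul_sum]
        exact Finset.sum_congr rfl fun j _ => by rw [coneCoeff]; ring
      rw [this, show ∑ j, coneCoeff ν l j * n j = 0 from hlat, mul_zero]
    · exact mul_ne_zero (hne j) (hpos j).ne'
  · rintro ⟨l, s, n⟩ hx ⟨l', s', n'⟩ hx' heq
    simp only [Finset.coe_sigma, Set.mem_sigma_iff, Finset.mem_coe, Finset.mem_univ, true_and,
      Finset.mem_product, mem_boxed_natAbs] at hx hx'
    obtain ⟨hs, -, ⟨⟨-, hpos⟩, -⟩⟩ := hx
    obtain ⟨hs', -, ⟨⟨-, hpos'⟩, -⟩⟩ := hx'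
    have hj : ∀ j, s * signVec l j = s' * signVec l' j ∧ n j = n' j := by
      intro j
      have h := congrFun heq j
      simp only at h
      have p := hpos j
      have p' := hpos' j
      rcases mul_self_eq_one_iff.1 (hu l s hs j) with e | e <;>
        rcases mul_self_eq_one_iff.1 (hu l' s' hs' j) with e' | e' <;>
        rw [e, e'] at h ⊢ <;> constructor <;> linarith
    obtain ⟨rfl, rfl⟩ := signVec_injective l l' s hs s' hs' fun j => (hj j).1
    obtain rfl : n = n' := funext fun j => (hj j).2
    rfl
  · intro n hn
    rw [Finset.mem_coe, mem_boxed_natAbs] at hn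
    obtain ⟨hb, hperp, hg⟩ := hn
    obtain ⟨l, s, hs, hpos⟩ := exists_signVec_mul_pos hν_pos hperp
    refine ⟨⟨l, s, fun j => s * signVec l j * n j⟩, ?_, ?_⟩
    · simp only [Finset.coe_sigma, Set.mem_sigma_iff, Finset.mem_coe, Finset.mem_univ, true_and,
        Finset.mem_product, mem_boxed_natAbs]
      refine ⟨hs, fun j => ?_, ⟨?_, hpos⟩, gcd_sign (hu l s hs) hg⟩
      · have : (s * signVec l j).natAbs = 1 := by
          rcases mul_self_eq_one_iff.1 (hu l s hs j) with h | h <;> simp [h]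
        rw [Int.natAbs_mul, this, one_mul]
        exact hb j
      · have : ∑ j, coneCoeff ν l j * (s * signVec l j * n j) = s * ∑ j, (ν j : ℤ) * n j := by
          rw [Finset.mul_sum]
          refine Finset.sum_congr rfl fun j _ => ?_
          rw [coneCoeff]
          linear_combination (s * ν j * n j) * signVec_sq l j
        change ∑ j, coneCoeff ν l j * (s * signVec l j * n j) = 0
        rw [this, hperp.1, mul_zero]
    · funext j
      simp only
      rw [← mul_assoc, hu l s hs j, one_mul]
  · intros; rfl

lemma eventually_partialSum_primPerp {ν : Fin 3 → ℕ}
    (hν_coprime : Pairwise fun i j => Nat.Coprime (ν i) (ν j)) (hν_pos : ∀ j, 0 < ν j)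
    (q : Fin 3 → ℕ) (k : Fin 3) (heven : Even (∑ j, dropAt q k j)) :
    ∀ᶠ N in atTop, partialSum (primPerp ν) (dropAt q k) N = 2 * QPartial k ν q N := by
  -- The ray terms in `QPartial` are never truncated, so the identity needs a cube containing all of
  -- these finitely many rays.
  have h : ∀ᶠ N : ℕ in atTop, ∀ l : Fin 3, ∀ i ∈ Finset.Icc 1 (rayCount ν l), ∀ j,
      (ray ν l i j).natAbs ≤ N := by
    rw [eventually_all]
    intro l
    rw [Filter.eventually_all_finset]
    intro i _
    rw [eventually_all]
    exact fun j => eventually_ge_atTop _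
  filter_upwards [h] with N hN
  rw [partialSum_primPerp hν_pos q k heven, QPartial, combine]
  congr 1
  exact Finset.sum_congr rfl fun l _ => by
    rw [partialSum_primCone hν_coprime hν_pos l _ (hN l)]

/-! ### Assembly of the identity -/

lemma coneCoeff_ne_zero {ν : Fin 3 → ℕ} (hν_pos : ∀ j, 0 < ν j) (l k : Fin 3) :
    coneCoeff ν l k ≠ 0 := by
  refine mul_ne_zero (fun h => ?_) (by exact_mod_cast (hν_pos k).ne')
  have := signVec_sq l k
  rw [h] at this
  norm_num at this

/-- The identity for a single index `k`. -/
lemma exists_limits {ν q : Fin 3 → ℕ} (hν_pos : ∀ j, 0 < ν j) (hν_inj : Function.Injective ν)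
    (hν_coprime : Pairwise fun i j => Nat.Coprime (ν i) (ν j))
    (hq_pos : ∀ j, 0 < q j) (hq_even : Even (barWeight q)) {k : Fin 3} (hk : q k = 1) :
    ∃ Y Qk : ℝ, Tendsto (YPartial k ν q) atTop (𝓝 Y) ∧ Tendsto (QPartial k ν q) atTop (𝓝 Qk) ∧
      ((∀ j, j ≠ k → 2 ≤ q j) →
          HasSum (fun n : perp ν => invPow n (dropAt q k)) Y ∧
          (∀ l, ∀ i ≤ rayCount ν l,
            Summable fun n : primitivePoints (subCone ν l i) => invPow n (dropAt q k)) ∧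
          Qk = Q k ν q) ∧
      (Y : ℂ) = 2 * riemannZeta (barWeight q : ℂ) * (Qk : ℂ) := by
  obtain ⟨i, j, hij, hik, hjk⟩ : ∃ i j : Fin 3, i ≠ j ∧ i ≠ k ∧ j ≠ k :=
    (by decide : ∀ k : Fin 3, ∃ i j : Fin 3, i ≠ j ∧ i ≠ k ∧ j ≠ k) k
  obtain ⟨Y, hY⟩ := exists_tendsto_YPartial hν_pos hν_inj hν_coprime hq_pos hq_even hk
  have hbar : barWeight q = q i + q j := by
    rw [barWeight, sum_fin_three_of_ne hij hik hjk, hk]; rfl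
  have hdrop : ∑ t, dropAt q k t = barWeight q := by
    rw [hbar, sum_fin_three_of_ne hij hik hjk]
    simp [dropAt, Function.update_of_ne hik, Function.update_of_ne hjk]
  have hw2 : 2 ≤ barWeight q := by
    have := hq_pos i
    have := hq_pos j
    omega
  obtain ⟨P, hP, hYP⟩ := exists_tendsto_primPerp hdrop hw2 hY
  -- The cone decomposition makes the primitive limit `P` twice the limit of `QPartial`, so its
  -- existence is inherited from `Y`.
  have hQ : Tendsto (QPartial k ν q) atTop (𝓝 (P / 2)) := by
    refine (hP.div_const 2).congr' ?_
    filter_upwards [eventually_partialSum_primPerp hν_coprime hν_pos q k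
      (hdrop ▸ hq_even)] with N hN
    rw [hN]; ring
  refine ⟨Y, P / 2, hY, hQ, fun h2 => ?_, ?_⟩
  · have hsum : Summable fun n : perp ν => invPow n (dropAt q k) :=
      summable_invPow_of_two_le hij hik hjk (c := fun t => (ν t : ℤ))
        (by exact_mod_cast (hν_pos k).ne') (h2 i hik) (h2 j hjk) fun n hn => hn.1
    have hsub : ∀ l, ∀ i ≤ rayCount ν l,
        Summable fun n : primitivePoints (subCone ν l i) => invPow n (dropAt q k) := fun l i' hi' =>
      summable_invPow_of_two_le hij hik hjk (coneCoeff_ne_zero hν_pos l k) (h2 i hik) (h2 j hjk)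
        fun n hn => (primitivePoints_subCone_subset hν_coprime hν_pos hi' hn).1.1
    refine ⟨?_, hsub, ?_⟩
    · rw [tendsto_nhds_unique hY (tendsto_partialSum hsum)]
      exact hsum.hasSum
    · refine tendsto_nhds_unique hQ ?_
      unfold QPartial Q combine
      apply tendsto_finsetSum
      intro l _
      apply Tendsto.const_mul
      apply Tendsto.add tendsto_const_nhds
      exact tendsto_finsetSum _ fun i hi => tendsto_partialSum
        (hsub l i (Nat.lt_succ_iff.1 (Finset.mem_range.1 hi)))
  · rw [zeta_nat_eq_tsum_of_gt_one hw2, hYP]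
    push_cast
    simp only [one_div]
    ring

end ConicalReciprocity

open ConicalReciprocity in
theorem mainTheorem6 (ν q : Fin 3 → ℕ)
    (hν_pos : ∀ j, 0 < ν j) (hν_inj : Function.Injective ν)
    (hν_coprime : Pairwise fun i j => Nat.Coprime (ν i) (ν j))
    (hq_pos : ∀ j, 0 < q j) (hq_even : Even (barWeight q)) :
    ∃ Yv Qv : Fin 3 → ℝ,
      (∀ k, q k = 1 →
        Filter.Tendsto (YPartial k ν q) Filter.atTop (nhds (Yv k)) ∧
        Filter.Tendsto (QPartial k ν q) Filter.atTop (nhds (Qv k)) ∧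
        ((∀ j, j ≠ k → 2 ≤ q j) →
          HasSum (fun n : perp ν => invPow n (dropAt q k)) (Yv k) ∧
          (∀ l, ∀ i ≤ rayCount ν l,
            Summable fun n : primitivePoints (subCone ν l i) => invPow n (dropAt q k)) ∧
          Qv k = Q k ν q)) ∧
      ((∑ k with q k = 1, Yv k : ℝ) : ℂ)
        = 2 * riemannZeta (barWeight q : ℂ) * ((∑ k with q k = 1, Qv k : ℝ) : ℂ) := by
  have h : ∀ k, ∃ Y Qk : ℝ, q k = 1 → _ := fun k => by
    by_cases hk : q k = 1
    · obtain ⟨Y, Qk, h⟩ := exists_limits hν_pos hν_inj hν_coprime hq_pos hq_even hk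
      exact ⟨Y, Qk, fun _ => h⟩
    · exact ⟨0, 0, fun h => absurd h hk⟩
  choose Yv Qv h using h
  refine ⟨Yv, Qv, fun k hk => ⟨(h k hk).1, (h k hk).2.1, (h k hk).2.2.1⟩, ?_⟩
  push_cast
  rw [Finset.mul_sum]
  exact Finset.sum_congr rfl fun k hk => (h k (Finset.mem_filter.1 hk).2).2.2.2
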